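/- Let $\Omega\subset\mathbb{R}^2$ be an open set whose boundary $\partial\Omega$ is compact and smooth (near each boundary point, in suitable orthonormal coordinates, $\Omega$ is the region on one side of the graph of a $C^\infty$ function), let $\nu$ be the outward unit normal on $\partial\Omega$, and let $\mu:\partial\Omega\to\mathbb{R}$ be $C^\infty$. For $\delta>0$ and $x\in\partial\Omega$ let $$\mathcal{D}_L[\mu](x)=\int_0^{\delta}\int_{\partial\Omega}\frac{\partial}{\partial\nu_{x'}}\left(\frac{e^{-\|x-x'\|^2/4t}}{4\pi t}\right)\mu(x')\,\mathrm{d}s_{x'}\,\mathrm{d}t$$ be the local part of the double layer potential, where $\mathrm{d}s$ is arc length. For $b=x\in\partial\Omega$, take orthonormal coordinates $(\xi,\eta)$ centred at $b$ with the $\xi$-axis along the tangent line to $\partial\Omega$ at $b$ and the $\eta$-axis in the direction of the outward normal $\nu(b)$, write $\partial\Omega$ near $b$ as a graph $\eta=\gamma(\xi)$ with $\gamma(0)=\gamma'(0)=0$, and write $\mu(\xi)$ for the value of $\mu$ at the boundary point $(\xi,\gamma(\xi))$. Put $\kappa_b=\gamma''(0)$ (the signed curvature at $b$, which in this convention is $\le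 0$ where $\Omega$ is convex), $\gamma_b^{(k)}=\gamma^{(k)}(0)$, $\mu_b=\mu(0)$, $\mu_b'=\mu'(0)$, $\mu_b''=\mu''(0)$. Then, for every $x\in\partial\Omega$ and $\delta>0$, the boundary integral converges absolutely for each $t>0$ and defines an integrable function of $t\in(0,\delta)$, and, as $\delta\to0^+$, $$\mathcal{D}_L[\mu](x)=\sqrt{\delta}\,\frac{\kappa_b\mu_b}{2\sqrt{\pi}}+\delta^{3/2}\left(-\frac{5\kappa_b^3\mu_b}{8\sqrt{\pi}}+\frac{\kappa_b\mu_b''}{2\sqrt{\pi}}+\frac{2\mu_b'\gamma_b^{(3)}}{3\sqrt{\pi}}+\frac{\mu_b\gamma_b^{(4)}}{4\sqrt{\pi}}\right)+O(\delta^{5/2}),$$ uniformly in $x\in\partial\Omega$: there are $C$ and $\delta_0>0$, depending only on $\Omega$ and $\mu$, such that for all $x\in\partial\Omega$ and $0<\delta<\delta_0$ the error is at most $C\delta^{5/2}$ in absolute value. -/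

import Mathlib

open scoped ContDiff MeasureTheory

noncomputable section

/-- The Euclidean plane. -/
abbrev Plane : Type := EuclideanSpace ℝ (Fin 2)

/-- The point `b + ξ τ + η n`: the point with coordinates `(ξ, η)` in the frame `(τ, n)`
with origin `b`. -/
def framePoint (b τ n : Plane) (ξ η : ℝ) : Plane := b + ξ • τ + η • n

/-- Local representation of the boundary of `Ω` at `b` as a graph over its tangent line:
`(τ, n)` is an orthonormal frame, `γ` is smooth near `0` with `γ 0 = γ' 0 = 0`, and in a
neighbourhood of `b` the set `Ω` is the region `η < γ ξ` below the graph of `γ`. So `τ` spans the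
tangent line at `b`, `n` is the unit normal at `b` pointing out of `Ω`, and the boundary is the
curve `η = γ ξ` near `b`. -/
structure IsTangentGraph (Ω : Set Plane) (b τ n : Plane) (γ : ℝ → ℝ) : Prop where
  norm_tangent : ‖τ‖ = 1
  norm_normal : ‖n‖ = 1
  inner_eq_zero : inner ℝ τ n = 0
  value_zero : γ 0 = 0
  deriv_zero : deriv γ 0 = 0
  local_graph : ∃ r : ℝ, 0 < r ∧ ContDiffOn ℝ ∞ γ (Set.Ioo (-r) r) ∧
    ∀ ξ η : ℝ, |ξ| < r → |η| < r → (framePoint b τ n ξ η ∈ Ω ↔ η < γ ξ)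

/-- `Ω` has smooth boundary: near each of its boundary points, `Ω` is the region on one side of a
smooth graph over the tangent line. -/
def HasSmoothBoundary (Ω : Set Plane) : Prop :=
  ∀ b ∈ frontier Ω, ∃ (τ n : Plane) (γ : ℝ → ℝ), IsTangentGraph Ω b τ n γ

/-- `n` is the outward unit normal to the boundary of `Ω` at `b`. -/
def IsOutwardNormal (Ω : Set Plane) (b n : Plane) : Prop :=
  ∃ (τ : Plane) (γ : ℝ → ℝ), IsTangentGraph Ω b τ n γ

open Classical in
/-- The outward unit normal field on the boundary of `Ω` (zero where there is none). -/
def outwardNormal (Ω : Set Plane) (y : Plane) : Plane :=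
  if h : ∃ n, IsOutwardNormal Ω y n then h.choose else 0

/-- The heat kernel of the plane. -/
def heatKernel (z : Plane) (t : ℝ) : ℝ :=
  Real.exp (-‖z‖ ^ 2 / (4 * t)) / (4 * Real.pi * t)

/-- The derivative of `y ↦ heatKernel (x - y) t` at `y` in the direction of the outward normal
at `y`. -/
def doubleLayerKernel (Ω : Set Plane) (x : Plane) (t : ℝ) (y : Plane) : ℝ :=
  fderiv ℝ (fun z : Plane => heatKernel (x - z) t) y (outwardNormal Ω y)

/-- The inner (boundary) integral of the double layer heat potential with density `μ`, taken with
respect to arc length, that is, one-dimensional Hausdorff measure on the boundary. -/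
def doubleLayerInner (Ω : Set Plane) (μ : Plane → ℝ) (x : Plane) (t : ℝ) : ℝ :=
  ∫ y in frontier Ω, doubleLayerKernel Ω x t y * μ y ∂μH[1]

/-- The local part, with cutoff `δ` in time, of the double layer potential with density `μ`. -/
def localDoubleLayer (Ω : Set Plane) (μ : Plane → ℝ) (δ : ℝ) (x : Plane) : ℝ :=
  ∫ t in (0 : ℝ)..δ, doubleLayerInner Ω μ x t

/-- The `k`-th derivative at `b` of the density `μ` in the tangent line parametrization. -/
def tangentDeriv (μ : Plane → ℝ) (b τ n : Plane) (γ : ℝ → ℝ) (k : ℕ) : ℝ :=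
  iteratedDeriv k (fun ξ : ℝ => μ (framePoint b τ n ξ (γ ξ))) 0

end

/-!
The local double layer potential is computed in the tangent frame at the base point `x`. There the
boundary is a graph `u ↦ (u, g u)` with `g 0 = g' 0 = 0`, and the boundary integral near `x` equals
`(8 π t²)⁻¹ ∫ (u g' u - g u) exp (-(u² + (g u)²) / (4 t)) m u du`, where `m` is the density along
the graph: the factor `√(1 + g'²)` of arc length cancels the one that normalizes the normal
(`IsUniformChart.setIntegral_eq`). Replacing `g`, `m` and `exp (-(g u)² / (4 t))` by their Taylor
polynomials leaves Gaussian moments; those of orders 2, 4 and 6 give the terms of orders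
`t ^ (-1 / 2)` and `t ^ (1 / 2)`, and the remainder is `O(t ^ (3 / 2))`
(`tangent_integral_expansion`). The part of the boundary at distance at least `c` from `x`
contributes `O(t ^ (3 / 2))` as well, because `exp (-c² / (4 t))` beats all powers of `t`. Integration
over `t ∈ (0, δ)` gives the claim.

Arc length is one-dimensional Hausdorff measure, so a change of variables for Hausdorff measure on a
curve is required (`setIntegral_image_hausdorffMeasure`). It is proved by differentiation of
measures: the length measure, pulled back to the parameter line, has at each point the density
given by the speed of the curve.

The constants must not depend on `x`, nor on the choice of the tangent graph at `x`. The tangent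
frame at `x` is determined by the boundary up to the orientation of the tangent
(`IsGraphBox.frame_unique`), and so is the germ of the graph. If one graph `γ₀` describes the
boundary near `b`, then the graph over the tangent line at the point of abscissa `a` is found by
solving for the parameter; the inverse function theorem for
`(a, h) ↦ (a, tangentCoord γ₀ (a, h))` shows that it depends smoothly on `(a, u)` jointly, so its
derivatives and its interval of definition are controlled uniformly for `a` near `0`
(`IsGraphBox.exists_uniformChart`). Compactness of the boundary finishes the argument
(`exists_uniform_inner_expansion`).
-/

noncomputable section

open Set MeasureTheory Real Filter Topology
open scoped NNReal ENNReal

/-! ### Taylor expansion with explicit remainder -/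

/-- Taylor's formula at `0` with the remainder bounded by the top derivative. -/
theorem abs_sub_taylor_le {ρ M : ℝ} (n : ℕ) {f : ℝ → ℝ}
    (hf : ContDiffOn ℝ n f (Ioo (-ρ) ρ)) (hM : ∀ u ∈ Ioo (-ρ) ρ, |iteratedDeriv n f u| ≤ M)
    {u : ℝ} (hu : u ∈ Ioo (-ρ) ρ) :
    |f u - ∑ k ∈ Finset.range n, iteratedDeriv k f 0 * u ^ k / (k.factorial : ℝ)|
      ≤ M * |u| ^ n := by
  induction n generalizing f u with
  | zero => simpa using hM u hu
  | succ n ih =>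
    have hM0 : 0 ≤ M := (abs_nonneg _).trans (hM u hu)
    have hopen : IsOpen (Ioo (-ρ) ρ) := isOpen_Ioo
    have h1 := (contDiffOn_succ_iff_deriv_of_isOpen (n := n) hopen).1 (by exact_mod_cast hf)
    have key := fun {v : ℝ} (hv : v ∈ Ioo (-ρ) ρ) => ih (f := deriv f) h1.2.2
      (fun w hw => by simpa [iteratedDeriv_succ'] using hM w hw) hv
    set φ : ℝ → ℝ := fun v =>
      f v - ∑ k ∈ Finset.range (n + 1), iteratedDeriv k f 0 * v ^ k / (k.factorial : ℝ) with hφ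
    have hd : ∀ v ∈ Ioo (-ρ) ρ, HasDerivAt φ (deriv f v -
        ∑ k ∈ Finset.range n, iteratedDeriv k (deriv f) 0 * v ^ k / (k.factorial : ℝ)) v := by
      intro v hv
      have hfv : HasDerivAt f (deriv f v) v :=
        ((h1.1 v hv).differentiableAt (hopen.mem_nhds hv)).hasDerivAt
      refine hfv.sub ?_
      have hs : HasDerivAt (fun v : ℝ => ∑ k ∈ Finset.range (n + 1),
          iteratedDeriv k f 0 * v ^ k / (k.factorial : ℝ))
          (∑ k ∈ Finset.range (n + 1),
            iteratedDeriv k f 0 * (k * v ^ (k - 1)) / (k.factorial : ℝ)) v := by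
        refine HasDerivAt.fun_sum fun k _ => ?_
        exact ((hasDerivAt_pow k v).const_mul _).div_const _
      refine hs.congr_deriv ?_
      rw [Finset.sum_range_succ']
      simp only [Nat.cast_zero, zero_mul, mul_zero, zero_div, add_zero]
      refine Finset.sum_congr rfl fun k _ => ?_
      rw [iteratedDeriv_succ', Nat.factorial_succ, Nat.add_sub_cancel]
      have : (k.factorial : ℝ) ≠ 0 := by positivity
      push_cast
      field_simp
    have hφ0 : φ 0 = 0 := by
      simp only [hφ]
      rw [Finset.sum_range_succ']
      simp
    have hsub : Icc (-|u|) |u| ⊆ Ioo (-ρ) ρ := by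
      intro v hv
      have := abs_lt.2 hu
      exact ⟨by linarith [hv.1], by linarith [hv.2]⟩
    have hmv := Convex.norm_image_sub_le_of_norm_hasDerivWithin_le (f := φ) (C := M * |u| ^ n)
      (fun v hv => (hd v (hsub hv)).hasDerivWithinAt)
      (fun v hv => (key (hsub hv)).trans
        (mul_le_mul_of_nonneg_left (pow_le_pow_left₀ (abs_nonneg _) (abs_le.2 hv) n) hM0))
      (convex_Icc _ _) (show (0 : ℝ) ∈ Icc (-|u|) |u| by simp)
      (show u ∈ Icc (-|u|) |u| from abs_le.1 le_rfl)
    rw [hφ0, sub_zero, sub_zero, norm_eq_abs, norm_eq_abs, mul_assoc, ← pow_succ] at hmv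
    exact hmv

/-! ### Gaussian moments -/

theorem integrable_pow_mul_gaussian {t : ℝ} (ht : 0 < t) (k : ℕ) :
    Integrable fun u : ℝ => u ^ k * exp (-u ^ 2 / (4 * t)) := by
  have h := integrable_rpow_mul_exp_neg_mul_sq (b := 1 / (4 * t)) (by positivity) (s := k)
    (by have := Nat.cast_nonneg (α := ℝ) k; linarith)
  refine h.congr (Filter.Eventually.of_forall fun u => ?_)
  simp only [rpow_natCast]
  congr 2
  ring

/-- The moments of the Gaussian of variance `2 t`, without normalization. -/
def gaussianMoment (k : ℕ) (t : ℝ) : ℝ := ∫ u : ℝ, u ^ k * exp (-u ^ 2 / (4 * t))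

theorem hasDerivAt_gaussian {t : ℝ} (ht : 0 < t) (u : ℝ) :
    HasDerivAt (fun u : ℝ => exp (-u ^ 2 / (4 * t)))
      (-(u / (2 * t)) * exp (-u ^ 2 / (4 * t))) u := by
  have h := (((hasDerivAt_pow 2 u).neg).div_const (4 * t)).exp
  refine h.congr_deriv ?_
  simp only [Pi.neg_apply]
  push_cast
  field_simp
  ring

/-- Integration by parts: the derivative of `u ^ (k + 1) * exp (-u ^ 2 / (4 t))` integrates to zero. -/
theorem gaussianMoment_add_two {t : ℝ} (ht : 0 < t) (k : ℕ) :
    gaussianMoment (k + 2) t = 2 * t * (k + 1) * gaussianMoment k t := by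
  have hd : ∀ u : ℝ, HasDerivAt (fun u : ℝ => u ^ (k + 1) * exp (-u ^ 2 / (4 * t)))
      ((k + 1) * (u ^ k * exp (-u ^ 2 / (4 * t)))
        - (1 / (2 * t)) * (u ^ (k + 2) * exp (-u ^ 2 / (4 * t)))) u := by
    intro u
    refine ((hasDerivAt_pow (k + 1) u).mul (hasDerivAt_gaussian ht u)).congr_deriv ?_
    simp only [Nat.add_sub_cancel]
    push_cast
    field_simp
    ring
  have i0 := (integrable_pow_mul_gaussian ht k).const_mul ((k : ℝ) + 1)
  have i2 := (integrable_pow_mul_gaussian ht (k + 2)).const_mul (1 / (2 * t))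
  have h := integral_eq_zero_of_hasDerivAt_of_integrable hd (i0.sub i2)
    (integrable_pow_mul_gaussian ht (k + 1))
  rw [integral_sub i0 i2, integral_const_mul, integral_const_mul] at h
  change (k + 1) * gaussianMoment k t - 1 / (2 * t) * gaussianMoment (k + 2) t = 0 at h
  field_simp at h
  linarith

theorem gaussianMoment_zero {t : ℝ} (ht : 0 < t) : gaussianMoment 0 t = 2 * √π * √t := by
  have h := integral_gaussian (1 / (4 * t))
  unfold gaussianMoment
  rw [show π / (1 / (4 * t)) = 2 ^ 2 * (π * t) by field_simp; ring, sqrt_mul (by positivity),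
    sqrt_sq (by norm_num), sqrt_mul pi_pos.le, ← mul_assoc] at h
  rw [← h]
  congr 1
  ext u
  rw [pow_zero, one_mul]
  congr 1
  ring

theorem gaussianMoment_one {t : ℝ} (ht : 0 < t) : gaussianMoment 1 t = 0 := by
  have hd : ∀ u : ℝ, HasDerivAt (fun u : ℝ => (-(2 * t)) * exp (-u ^ 2 / (4 * t)))
      (u ^ 1 * exp (-u ^ 2 / (4 * t))) u := by
    intro u
    refine ((hasDerivAt_gaussian ht u).const_mul _).congr_deriv ?_
    field_simp
  refine integral_eq_zero_of_hasDerivAt_of_integrable hd (integrable_pow_mul_gaussian ht 1) ?_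
  simpa using (integrable_pow_mul_gaussian ht 0).const_mul (-(2 * t))

/-! ### Bounded families -/

/-- A family of reals that is bounded in absolute value. -/
def BddAbs {ι : Type*} (f : ι → ℝ) : Prop := ∃ C : ℝ, ∀ i, |f i| ≤ C

section BddAbs

variable {ι : Type*} {f g : ι → ℝ}

theorem bddAbs_const (c : ℝ) : BddAbs fun _ : ι => c := ⟨|c|, fun _ => le_rfl⟩

theorem BddAbs.add (hf : BddAbs f) (hg : BddAbs g) : BddAbs fun i => f i + g i := by
  obtain ⟨C, hC⟩ := hf
  obtain ⟨D, hD⟩ := hg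
  exact ⟨C + D, fun i => (abs_add_le _ _).trans (add_le_add (hC i) (hD i))⟩

theorem BddAbs.mul (hf : BddAbs f) (hg : BddAbs g) : BddAbs fun i => f i * g i := by
  obtain ⟨C, hC⟩ := hf
  obtain ⟨D, hD⟩ := hg
  exact ⟨C * D, fun i => by
    rw [abs_mul]
    exact mul_le_mul (hC i) (hD i) (abs_nonneg _) ((abs_nonneg _).trans (hC i))⟩

theorem BddAbs.div_const (hf : BddAbs f) (c : ℝ) : BddAbs fun i => f i / c := by
  simpa only [div_eq_mul_inv] using hf.mul (bddAbs_const c⁻¹)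

theorem BddAbs.pow (hf : BddAbs f) (n : ℕ) : BddAbs fun i => f i ^ n := by
  obtain ⟨C, hC⟩ := hf
  exact ⟨C ^ n, fun i => by
    rw [abs_pow]; exact pow_le_pow_left₀ (abs_nonneg _) (hC i) n⟩

end BddAbs

/-! ### Pointwise expansion of the integrand -/

/-- A quantity of size `O(u ^ n)` is `u ^ n` times a bounded coefficient. Where `u ^ n = 0` the
quotient is the junk value `0`, which serves as well since `a = 0` there. -/
theorem exists_eq_mul_pow_of_abs_le {a u M : ℝ} {n : ℕ} (hM : 0 ≤ M) (h : |a| ≤ M * |u| ^ n) :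
    |a / u ^ n| ≤ M ∧ a = a / u ^ n * u ^ n := by
  rcases eq_or_ne (u ^ n) 0 with h0 | h0
  · rw [← abs_pow, h0, abs_zero, mul_zero] at h
    have ha : a = 0 := abs_eq_zero.1 (le_antisymm h (abs_nonneg _))
    simp [ha, hM]
  · refine ⟨?_, (div_mul_cancel₀ a h0).symm⟩
    rw [abs_div, abs_pow]
    exact (div_le_iff₀ (by rw [← abs_pow]; positivity)).2 h

theorem exp_neg_expansion {z : ℝ} (hz : 0 ≤ z) : |exp (-z) - 1 + z| ≤ z ^ 2 := by
  rcases le_total z 1 with h | h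
  · have := abs_exp_sub_one_sub_id_le (x := -z) (by rwa [abs_neg, abs_of_nonneg hz])
    rwa [neg_sq, sub_neg_eq_add] at this
  · have h1 := exp_pos (-z)
    have h2 : exp (-z) ≤ 1 := exp_le_one_iff.2 (by linarith)
    rw [abs_le]
    constructor <;> nlinarith

/-- The polynomial in `u` (with coefficients depending on `t`) that approximates the integrand of
the double layer potential in the tangent parametrization. The curve contributes its Taylor
coefficients `a₀, a₁`, the normal component of `x - y` the coefficients `b₀, …, b₃`, the density
the coefficients `n₀, …, n₃`. -/
def integrandPoly (a₀ a₁ b₀ b₁ b₂ b₃ n₀ n₁ n₂ n₃ t u : ℝ) : ℝ :=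
  b₀ * n₀ * u ^ 2 + (b₀ * n₁ + b₁ * n₀) * u ^ 3 + (b₀ * n₂ + b₁ * n₁ + b₂ * n₀) * u ^ 4 +
    (b₀ * n₃ + b₁ * n₂ + b₂ * n₁ + b₃ * n₀) * u ^ 5 - (a₀ ^ 2 * (b₀ * n₀) / 4 / t) * u ^ 6 -
    ((a₀ ^ 2 * (b₀ * n₁ + b₁ * n₀) + 2 * a₀ * a₁ * (b₀ * n₀)) / 4 / t) * u ^ 7

/-- The error of the approximation by `integrandPoly` consists of the Taylor remainder of `B * m`,
the quadratic remainder of the exponential, and the terms of `B * m * g ^ 2` beyond the seventh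
power of `u`. -/
theorem integrand_error_eq {u t a₀ a₁ b₀ b₁ b₂ b₃ n₀ n₁ n₂ n₃ r₁ r₂ r₃ g B m E : ℝ}
    (ht : t ≠ 0)
    (hg : g = u ^ 2 * (a₀ + a₁ * u + r₁ * u ^ 2))
    (hB : B = u ^ 2 * (b₀ + b₁ * u + b₂ * u ^ 2 + b₃ * u ^ 3 + r₂ * u ^ 4))
    (hm : m = n₀ + n₁ * u + n₂ * u ^ 2 + n₃ * u ^ 3 + r₃ * u ^ 4) :
    B * E * m - integrandPoly a₀ a₁ b₀ b₁ b₂ b₃ n₀ n₁ n₂ n₃ t u =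
    u ^ 6 * ((b₁ * n₃ + b₂ * n₂ + b₃ * n₁) + (b₂ * n₃ + b₃ * n₂) * u + b₃ * n₃ * u ^ 2 +
      r₂ * (n₀ + n₁ * u + n₂ * u ^ 2 + n₃ * u ^ 3) +
      r₃ * (b₀ + b₁ * u + b₂ * u ^ 2 + b₃ * u ^ 3) + r₂ * r₃ * u ^ 4) * E +
    u ^ 2 * (b₀ * n₀ + (b₀ * n₁ + b₁ * n₀) * u + (b₀ * n₂ + b₁ * n₁ + b₂ * n₀) * u ^ 2 +
      (b₀ * n₃ + b₁ * n₂ + b₂ * n₁ + b₃ * n₀) * u ^ 3) *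
      (E - 1 + g ^ 2 / (4 * t)) -
    u ^ 8 / t * (b₀ * n₀ * (a₁ ^ 2 + 2 * (a₀ * r₁) + 2 * (a₁ * r₁ * u) + r₁ ^ 2 * u ^ 2) +
      (b₀ * n₁ + b₁ * n₀) * (2 * (a₀ * a₁) + u * (a₁ ^ 2 + 2 * (a₀ * r₁) + 2 * (a₁ * r₁ * u) +
        r₁ ^ 2 * u ^ 2)) +
      (b₀ * n₂ + b₁ * n₁ + b₂ * n₀ + (b₀ * n₃ + b₁ * n₂ + b₂ * n₁ + b₃ * n₀) * u) *
        (a₀ + a₁ * u + r₁ * u ^ 2) ^ 2) / 4 := by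
  rw [hB, hm, hg, integrandPoly]
  field_simp
  ring

theorem abs_integrand_error_le {C₁ C₂ C₃ u t p q s G g E : ℝ} (ht : 0 < t)
    (hC1 : |p| ≤ C₁) (hC2 : |q * G ^ 4| ≤ C₂) (hC3 : |s| ≤ C₃) (hg : g = u ^ 2 * G)
    (hE : |E - 1 + g ^ 2 / (4 * t)| ≤ (g ^ 2 / (4 * t)) ^ 2) (hE0 : 0 < E) (hE1 : E ≤ 1) :
    |u ^ 6 * p * E + u ^ 2 * q * (E - 1 + g ^ 2 / (4 * t)) - u ^ 8 / t * s / 4|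
      ≤ (C₁ + C₂ + C₃) * (u ^ 6 + u ^ 8 / t + u ^ 10 / t ^ 2) := by
  have h6 : 0 ≤ u ^ 6 := by positivity
  have h8 : 0 ≤ u ^ 8 / t := by positivity
  have h10 : 0 ≤ u ^ 10 / t ^ 2 := by positivity
  have c1 : 0 ≤ C₁ := (abs_nonneg _).trans hC1
  have c2 : 0 ≤ C₂ := (abs_nonneg _).trans hC2
  have c3 : 0 ≤ C₃ := (abs_nonneg _).trans hC3
  have e1 : |u ^ 6 * p * E| ≤ C₁ * u ^ 6 := by
    rw [abs_mul, abs_mul, abs_of_pos hE0, abs_of_nonneg h6, mul_comm (u ^ 6)]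
    exact (mul_le_of_le_one_right (by positivity) hE1).trans
      (mul_le_mul_of_nonneg_right hC1 h6)
  have e2 : |u ^ 2 * q * (E - 1 + g ^ 2 / (4 * t))| ≤ C₂ * (u ^ 10 / t ^ 2) := by
    rw [abs_mul _ (E - 1 + g ^ 2 / (4 * t))]
    refine (mul_le_mul_of_nonneg_left hE (abs_nonneg _)).trans ?_
    rw [abs_mul, abs_of_nonneg (by positivity : 0 ≤ u ^ 2)]
    rw [abs_mul, abs_of_nonneg (by positivity : 0 ≤ G ^ 4)] at hC2
    calc _ = (|q| * G ^ 4) * (u ^ 10 / t ^ 2 / 16) := by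
          rw [hg]; field_simp; ring
      _ ≤ C₂ * (u ^ 10 / t ^ 2 / 16) := mul_le_mul_of_nonneg_right hC2 (by positivity)
      _ ≤ _ := mul_le_mul_of_nonneg_left (div_le_self h10 (by norm_num)) c2
  have e3 : |u ^ 8 / t * s / 4| ≤ C₃ * (u ^ 8 / t) := by
    rw [abs_div, abs_mul, abs_of_nonneg h8, abs_of_pos (by norm_num : (0 : ℝ) < 4)]
    have := mul_le_mul_of_nonneg_left hC3 h8
    have h0 : 0 ≤ u ^ 8 / t * C₃ := by positivity
    linarith
  refine (abs_sub _ _).trans ?_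
  refine (add_le_add ((abs_add_le _ _).trans (add_le_add e1 e2)) e3).trans ?_
  nlinarith [mul_nonneg c1 h8, mul_nonneg c1 h10, mul_nonneg c2 h6, mul_nonneg c2 h8,
    mul_nonneg c3 h6, mul_nonneg c3 h10]

/-- Pointwise expansion of the integrand in the tangent parametrization, up to a remainder whose
Gaussian integral is `O(t ^ (7 / 2))`. -/
theorem integrand_expansion {ι : Type*} {u t a₀ a₁ b₀ b₁ b₂ b₃ n₀ n₁ n₂ n₃ r₁ r₂ r₃ : ι → ℝ}
    (ht : ∀ i, 0 < t i) (hu : BddAbs u) (ha0 : BddAbs a₀) (ha1 : BddAbs a₁)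
    (hb0 : BddAbs b₀) (hb1 : BddAbs b₁) (hb2 : BddAbs b₂) (hb3 : BddAbs b₃)
    (hn0 : BddAbs n₀) (hn1 : BddAbs n₁) (hn2 : BddAbs n₂) (hn3 : BddAbs n₃)
    (hr1 : BddAbs r₁) (hr2 : BddAbs r₂) (hr3 : BddAbs r₃) :
    ∃ C, 0 ≤ C ∧ ∀ i, ∀ g B m : ℝ,
      g = u i ^ 2 * (a₀ i + a₁ i * u i + r₁ i * u i ^ 2) →
      B = u i ^ 2 * (b₀ i + b₁ i * u i + b₂ i * u i ^ 2 + b₃ i * u i ^ 3 + r₂ i * u i ^ 4) →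
      m = n₀ i + n₁ i * u i + n₂ i * u i ^ 2 + n₃ i * u i ^ 3 + r₃ i * u i ^ 4 →
      |B * exp (-(g ^ 2 / (4 * t i))) * m -
        integrandPoly (a₀ i) (a₁ i) (b₀ i) (b₁ i) (b₂ i) (b₃ i) (n₀ i) (n₁ i) (n₂ i) (n₃ i)
          (t i) (u i)|
        ≤ C * (u i ^ 6 + u i ^ 8 / t i + u i ^ 10 / t i ^ 2) := by
  have hp1 : BddAbs fun i => (b₁ i * n₃ i + b₂ i * n₂ i + b₃ i * n₁ i) +
      (b₂ i * n₃ i + b₃ i * n₂ i) * u i + b₃ i * n₃ i * u i ^ 2 +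
      r₂ i * (n₀ i + n₁ i * u i + n₂ i * u i ^ 2 + n₃ i * u i ^ 3) +
      r₃ i * (b₀ i + b₁ i * u i + b₂ i * u i ^ 2 + b₃ i * u i ^ 3) + r₂ i * r₃ i * u i ^ 4 := by
    repeat' first | assumption | apply BddAbs.add | apply BddAbs.mul | apply BddAbs.pow
  have hq : BddAbs fun i => b₀ i * n₀ i + (b₀ i * n₁ i + b₁ i * n₀ i) * u i +
      (b₀ i * n₂ i + b₁ i * n₁ i + b₂ i * n₀ i) * u i ^ 2 +
      (b₀ i * n₃ i + b₁ i * n₂ i + b₂ i * n₁ i + b₃ i * n₀ i) * u i ^ 3 := by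
    repeat' first | assumption | apply BddAbs.add | apply BddAbs.mul | apply BddAbs.pow
  have hG : BddAbs fun i => a₀ i + a₁ i * u i + r₁ i * u i ^ 2 := by
    repeat' first | assumption | apply BddAbs.add | apply BddAbs.mul | apply BddAbs.pow
  have hs : BddAbs fun i => a₁ i ^ 2 + 2 * (a₀ i * r₁ i) + 2 * (a₁ i * r₁ i * u i) +
      r₁ i ^ 2 * u i ^ 2 := by
    repeat' first | assumption | apply bddAbs_const | apply BddAbs.add | apply BddAbs.mul
  have hp2 : BddAbs fun i => b₀ i * n₀ i * (a₁ i ^ 2 + 2 * (a₀ i * r₁ i) +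
        2 * (a₁ i * r₁ i * u i) + r₁ i ^ 2 * u i ^ 2) +
      (b₀ i * n₁ i + b₁ i * n₀ i) * (2 * (a₀ i * a₁ i) + u i * (a₁ i ^ 2 + 2 * (a₀ i * r₁ i) +
        2 * (a₁ i * r₁ i * u i) + r₁ i ^ 2 * u i ^ 2)) +
      (b₀ i * n₂ i + b₁ i * n₁ i + b₂ i * n₀ i +
        (b₀ i * n₃ i + b₁ i * n₂ i + b₂ i * n₁ i + b₃ i * n₀ i) * u i) *
        (a₀ i + a₁ i * u i + r₁ i * u i ^ 2) ^ 2 := by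
    repeat' first | assumption | apply bddAbs_const | apply BddAbs.add | apply BddAbs.mul
  obtain ⟨C₁, hC1⟩ := hp1
  obtain ⟨C₂, hC2⟩ := hq.mul (hG.pow 4)
  obtain ⟨C₃, hC3⟩ := hp2
  refine ⟨|C₁| + |C₂| + |C₃|, by positivity, fun i g B m hg hB hm => ?_⟩
  have hti := ht i
  have hE := exp_neg_expansion (z := g ^ 2 / (4 * t i)) (by positivity)
  have hE1 : exp (-(g ^ 2 / (4 * t i))) ≤ 1 := exp_le_one_iff.2 (neg_nonpos.2 (by positivity))
  rw [integrand_error_eq hti.ne' hg hB hm]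
  exact abs_integrand_error_le hti ((hC1 i).trans (le_abs_self _))
    ((hC2 i).trans (le_abs_self _)) ((hC3 i).trans (le_abs_self _)) hg hE (exp_pos _) hE1

/-! ### The Gaussian integral of the expansion -/

/-- The integral over `S` of `f` is compared with the integral of `P` over the whole line: on `S` the
difference `f - P` is controlled, off `S` the function `P` itself. -/
theorem abs_setIntegral_sub_integral_le {S : Set ℝ} (hS : MeasurableSet S) {f P b : ℝ → ℝ}
    (hf : AEStronglyMeasurable f (volume.restrict S)) (hP : Integrable P) (hb : Integrable b)
    (hin : ∀ u ∈ S, |f u - P u| ≤ b u) (hout : ∀ u ∉ S, |P u| ≤ b u) :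
    |(∫ u in S, f u) - ∫ u, P u| ≤ ∫ u, b u := by
  have hle : ∀ u, ‖S.indicator f u - P u‖ ≤ b u := by
    intro u
    by_cases hu : u ∈ S
    · simpa [hu] using hin u hu
    · simpa [hu] using hout u hu
  have hfi : AEStronglyMeasurable (S.indicator f) volume :=
    (aestronglyMeasurable_indicator_iff hS).2 hf
  have hdiff : Integrable fun u => S.indicator f u - P u :=
    hb.mono' (hfi.sub hP.aestronglyMeasurable) (Filter.Eventually.of_forall hle)
  have hfint : Integrable (S.indicator f) := by
    have := hdiff.add hP
    simpa [Pi.add_def] using this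
  rw [← integral_indicator hS, ← integral_sub hfint hP]
  exact norm_integral_le_of_norm_le hb (Filter.Eventually.of_forall hle)

theorem gaussianMoment_two {t : ℝ} (ht : 0 < t) :
    gaussianMoment 2 t = 4 * √π * (t * √t) := by
  rw [gaussianMoment_add_two ht 0, gaussianMoment_zero ht]
  push_cast
  ring

theorem gaussianMoment_four {t : ℝ} (ht : 0 < t) :
    gaussianMoment 4 t = 24 * √π * (t ^ 2 * √t) := by
  rw [gaussianMoment_add_two ht 2, gaussianMoment_two ht]
  push_cast
  ring

theorem gaussianMoment_six {t : ℝ} (ht : 0 < t) :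
    gaussianMoment 6 t = 240 * √π * (t ^ 3 * √t) := by
  rw [gaussianMoment_add_two ht 4, gaussianMoment_four ht]
  push_cast
  ring

theorem gaussianMoment_eight {t : ℝ} (ht : 0 < t) :
    gaussianMoment 8 t = 3360 * √π * (t ^ 4 * √t) := by
  rw [gaussianMoment_add_two ht 6, gaussianMoment_six ht]
  push_cast
  ring

theorem gaussianMoment_ten {t : ℝ} (ht : 0 < t) :
    gaussianMoment 10 t = 60480 * √π * (t ^ 5 * √t) := by
  rw [gaussianMoment_add_two ht 8, gaussianMoment_eight ht]
  push_cast
  ring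

theorem gaussianMoment_odd {t : ℝ} (ht : 0 < t) :
    gaussianMoment 3 t = 0 ∧ gaussianMoment 5 t = 0 ∧ gaussianMoment 7 t = 0 := by
  have h3 : gaussianMoment 3 t = 0 := by
    rw [gaussianMoment_add_two ht 1, gaussianMoment_one ht, mul_zero]
  have h5 : gaussianMoment 5 t = 0 := by rw [gaussianMoment_add_two ht 3, h3, mul_zero]
  exact ⟨h3, h5, by rw [gaussianMoment_add_two ht 5, h5, mul_zero]⟩

theorem integrable_poly_gaussian {t : ℝ} (ht : 0 < t) (c₂ c₃ c₄ c₅ c₆ c₇ : ℝ) :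
    Integrable fun u : ℝ => (c₂ * u ^ 2 + c₃ * u ^ 3 + c₄ * u ^ 4 + c₅ * u ^ 5 - c₆ * u ^ 6 -
      c₇ * u ^ 7) * exp (-u ^ 2 / (4 * t)) := by
  have i := fun (c : ℝ) n => (integrable_pow_mul_gaussian ht n).const_mul c
  refine ((((((i c₂ 2).add (i c₃ 3)).add (i c₄ 4)).add (i c₅ 5)).sub (i c₆ 6)).sub
    (i c₇ 7)).congr (Filter.Eventually.of_forall fun u => ?_)
  simp only [Pi.add_apply, Pi.sub_apply]
  ring

theorem integral_poly_gaussian {t : ℝ} (ht : 0 < t) (c₂ c₃ c₄ c₅ c₆ c₇ : ℝ) :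
    ∫ u : ℝ, (c₂ * u ^ 2 + c₃ * u ^ 3 + c₄ * u ^ 4 + c₅ * u ^ 5 - c₆ * u ^ 6 -
      c₇ * u ^ 7) * exp (-u ^ 2 / (4 * t)) =
      c₂ * gaussianMoment 2 t + c₄ * gaussianMoment 4 t - c₆ * gaussianMoment 6 t := by
  have i := fun (c : ℝ) n => (integrable_pow_mul_gaussian ht n).const_mul c
  obtain ⟨h3, h5, h7⟩ := gaussianMoment_odd ht
  have e : ∀ u : ℝ, (c₂ * u ^ 2 + c₃ * u ^ 3 + c₄ * u ^ 4 + c₅ * u ^ 5 - c₆ * u ^ 6 -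
      c₇ * u ^ 7) * exp (-u ^ 2 / (4 * t)) = c₂ * (u ^ 2 * exp (-u ^ 2 / (4 * t))) +
      c₃ * (u ^ 3 * exp (-u ^ 2 / (4 * t))) + c₄ * (u ^ 4 * exp (-u ^ 2 / (4 * t))) +
      c₅ * (u ^ 5 * exp (-u ^ 2 / (4 * t))) - c₆ * (u ^ 6 * exp (-u ^ 2 / (4 * t))) -
      c₇ * (u ^ 7 * exp (-u ^ 2 / (4 * t))) := fun u => by ring
  simp only [e]
  have i2 := i c₂ 2
  have i23 := i2.add (i c₃ 3)
  have i24 := i23.add (i c₄ 4)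
  have i25 := i24.add (i c₅ 5)
  have i26 := i25.sub (i c₆ 6)
  simp only [Pi.add_def, Pi.sub_def] at i23 i24 i25 i26
  rw [integral_sub i26 (i c₇ 7), integral_sub i25 (i c₆ 6), integral_add i24 (i c₅ 5),
    integral_add i23 (i c₄ 4), integral_add i2 (i c₃ 3)]
  simp only [integral_const_mul]
  change c₂ * gaussianMoment 2 t + c₃ * gaussianMoment 3 t + c₄ * gaussianMoment 4 t +
    c₅ * gaussianMoment 5 t - c₆ * gaussianMoment 6 t - c₇ * gaussianMoment 7 t = _
  rw [h3, h5, h7]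
  ring

theorem integrable_remainder_gaussian {t : ℝ} (ht : 0 < t) (C : ℝ) :
    Integrable fun u : ℝ => C * (u ^ 6 + u ^ 8 / t + u ^ 10 / t ^ 2) * exp (-u ^ 2 / (4 * t)) := by
  have i := fun (c : ℝ) n => (integrable_pow_mul_gaussian ht n).const_mul c
  refine (((i C 6).add (i (C / t) 8)).add (i (C / t ^ 2) 10)).congr
    (Filter.Eventually.of_forall fun u => ?_)
  simp only [Pi.add_apply]
  ring

/-- The constant is `240 + 3360 + 60480`, from the moments of orders `6`, `8` and `10`. -/
theorem integral_remainder_gaussian {t : ℝ} (ht : 0 < t) (C : ℝ) :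
    ∫ u : ℝ, C * (u ^ 6 + u ^ 8 / t + u ^ 10 / t ^ 2) * exp (-u ^ 2 / (4 * t)) =
      64080 * C * √π * (t ^ 3 * √t) := by
  have i := fun (c : ℝ) n => (integrable_pow_mul_gaussian ht n).const_mul c
  have e : ∀ u : ℝ, C * (u ^ 6 + u ^ 8 / t + u ^ 10 / t ^ 2) * exp (-u ^ 2 / (4 * t)) =
      C * (u ^ 6 * exp (-u ^ 2 / (4 * t))) + C / t * (u ^ 8 * exp (-u ^ 2 / (4 * t))) +
      C / t ^ 2 * (u ^ 10 * exp (-u ^ 2 / (4 * t))) := fun u => by ring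
  simp only [e]
  have i6 := i C 6
  have i68 := i6.add (i (C / t) 8)
  simp only [Pi.add_def] at i68
  rw [integral_add i68 (i _ 10), integral_add i6 (i _ 8)]
  simp only [integral_const_mul]
  change C * gaussianMoment 6 t + C / t * gaussianMoment 8 t +
    C / t ^ 2 * gaussianMoment 10 t = _
  rw [gaussianMoment_six ht, gaussianMoment_eight ht, gaussianMoment_ten ht]
  field_simp
  ring

/-- Away from the origin, the low powers of `u` are dominated by the remainder terms. -/
theorem abs_poly_le_of_le_abs {ρ K t u c₂ c₃ c₄ c₅ c₆ c₇ : ℝ} (hρ : 0 < ρ) (ht : 0 < t)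
    (hu : ρ ≤ |u|) (h2 : |c₂| ≤ K) (h3 : |c₃| ≤ K) (h4 : |c₄| ≤ K) (h5 : |c₅| ≤ K)
    (h6 : |c₆| ≤ K) (h7 : |c₇| ≤ K) :
    |c₂ * u ^ 2 + c₃ * u ^ 3 + c₄ * u ^ 4 + c₅ * u ^ 5 - (c₆ / t) * u ^ 6 - (c₇ / t) * u ^ 7| ≤
      K * (1 / ρ ^ 4 + 1 / ρ ^ 3 + 1 / ρ ^ 2 + 1 / ρ + 1 / ρ ^ 2 + 1 / ρ) *
        (u ^ 6 + u ^ 8 / t + u ^ 10 / t ^ 2) := by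
  have hK : 0 ≤ K := (abs_nonneg _).trans h2
  have term : ∀ (c : ℝ) (a b : ℕ), |c| ≤ K → |c * u ^ a| ≤ K * (1 / ρ ^ b) * |u| ^ (a + b) := by
    intro c a b hc
    rw [abs_mul, abs_pow]
    have h1 : 1 ≤ 1 / ρ ^ b * |u| ^ b := by
      rw [one_div, inv_mul_eq_div, one_le_div (by positivity)]
      exact pow_le_pow_left₀ hρ.le hu b
    calc |c| * |u| ^ a ≤ K * |u| ^ a * 1 := by rw [mul_one]; gcongr
      _ ≤ K * |u| ^ a * (1 / ρ ^ b * |u| ^ b) := by gcongr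
      _ = _ := by ring
  have e6 : |u| ^ 6 = u ^ 6 := by rw [← abs_pow]; exact abs_of_nonneg (by positivity)
  have e8 : |u| ^ 8 = u ^ 8 := by rw [← abs_pow]; exact abs_of_nonneg (by positivity)
  have t2 := term c₂ 2 4 h2
  have t3 := term c₃ 3 3 h3
  have t4 := term c₄ 4 2 h4
  have t5 := term c₅ 5 1 h5
  have t6 : |c₆ / t * u ^ 6| ≤ K * (1 / ρ ^ 2) * (u ^ 8 / t) := by
    have := term c₆ 6 2 h6
    rw [show c₆ / t * u ^ 6 = c₆ * u ^ 6 / t by ring, abs_div, abs_of_pos ht, div_le_iff₀ ht]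
    rw [e8] at this
    refine this.trans (le_of_eq ?_)
    field_simp
  have t7 : |c₇ / t * u ^ 7| ≤ K * (1 / ρ) * (u ^ 8 / t) := by
    have := term c₇ 7 1 h7
    rw [show c₇ / t * u ^ 7 = c₇ * u ^ 7 / t by ring, abs_div, abs_of_pos ht, div_le_iff₀ ht]
    rw [e8, pow_one] at this
    refine this.trans (le_of_eq ?_)
    field_simp
  rw [show 2 + 4 = 6 from rfl, e6] at t2
  rw [show 3 + 3 = 6 from rfl, e6] at t3
  rw [show 4 + 2 = 6 from rfl, e6] at t4
  rw [show 5 + 1 = 6 from rfl, e6, pow_one] at t5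
  have n6 : 0 ≤ u ^ 6 := by positivity
  have n8 : 0 ≤ u ^ 8 / t := by positivity
  have n10 : 0 ≤ u ^ 10 / t ^ 2 := by positivity
  have p1 : 0 ≤ K * (1 / ρ) := by positivity
  have p2 : 0 ≤ K * (1 / ρ ^ 2) := by positivity
  have p3 : 0 ≤ K * (1 / ρ ^ 3) := by positivity
  have p4 : 0 ≤ K * (1 / ρ ^ 4) := by positivity
  have q : ∀ a b c d e f : ℝ, |a + b + c + d - e - f| ≤ |a| + |b| + |c| + |d| + |e| + |f| := by
    intro a b c d e f
    refine (abs_sub _ _).trans (add_le_add_left ((abs_sub _ _).trans (add_le_add_left ?_ _)) _)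
    refine (abs_add_le _ _).trans (add_le_add_left ((abs_add_le _ _).trans
      (add_le_add_left (abs_add_le _ _) _)) _)
  refine (q _ _ _ _ _ _).trans ?_
  nlinarith [mul_nonneg p1 n6, mul_nonneg p1 n8, mul_nonneg p1 n10, mul_nonneg p2 n6,
    mul_nonneg p2 n8, mul_nonneg p2 n10, mul_nonneg p3 n6, mul_nonneg p3 n8, mul_nonneg p3 n10,
    mul_nonneg p4 n6, mul_nonneg p4 n8, mul_nonneg p4 n10]

/-- The first two terms of the expansion in `t` of the boundary integral; here `k, g₃, g₄` are
derivatives of the curve and `m₀, m₁, m₂` derivatives of the density. -/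
def innerExpansion (k g₃ g₄ m₀ m₁ m₂ t : ℝ) : ℝ :=
  k * m₀ / (4 * √π) / √t +
    (3 * k * m₂ + 4 * g₃ * m₁ + 3 / 2 * g₄ * m₀ - 15 / 4 * k ^ 3 * m₀) / (4 * √π) * √t

/-- The moments of orders `2`, `4` and `6` give the two terms of `innerExpansion`; the sixth moment
comes from the linear term of the exponential and produces the cube of the curvature. -/
theorem innerExpansion_eq {t : ℝ} (ht : 0 < t) (k g₃ g₄ m₀ m₁ m₂ : ℝ) :
    1 / (8 * π * t ^ 2) * (k / 2 * m₀ * (4 * √π * (t * √t)) +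
      (k / 2 * (m₂ / 2) + g₃ / 3 * m₁ + g₄ / 8 * m₀) * (24 * √π * (t ^ 2 * √t)) -
      (k / 2) ^ 2 * (k / 2 * m₀) / 4 / t * (240 * √π * (t ^ 3 * √t))) =
    innerExpansion k g₃ g₄ m₀ m₁ m₂ t := by
  have hst : 0 < √t := sqrt_pos.2 ht
  have hsp : 0 < √π := sqrt_pos.2 pi_pos
  have hp : π = √π ^ 2 := (sq_sqrt pi_pos.le).symm
  have hs : t = √t ^ 2 := (sq_sqrt ht.le).symm
  unfold innerExpansion
  rw [hp, sqrt_sq hsp.le]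
  generalize √t = s at *
  generalize √π = p at *
  subst hs
  field_simp
  ring

/-! ### Boundary data in the tangent parametrization -/

/-- Smooth data on `(-ρ, ρ)` with derivatives bounded by `M`: a curve `g` tangent to the axis at
the origin, and a density `m`. -/
structure BoundedTangentData (ρ M : ℝ) (g m : ℝ → ℝ) : Prop where
  contDiffOn_curve : ContDiffOn ℝ 6 g (Ioo (-ρ) ρ)
  contDiffOn_density : ContDiffOn ℝ 4 m (Ioo (-ρ) ρ)
  curve_bound : ∀ k ≤ 6, ∀ u ∈ Ioo (-ρ) ρ, |iteratedDeriv k g u| ≤ M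
  density_bound : ∀ k ≤ 4, ∀ u ∈ Ioo (-ρ) ρ, |iteratedDeriv k m u| ≤ M
  value_zero : g 0 = 0
  deriv_zero : deriv g 0 = 0

namespace BoundedTangentData

variable {ρ M : ℝ} {g m : ℝ → ℝ}

theorem curve_taylor (h : BoundedTangentData ρ M g m) {u : ℝ} (hu : u ∈ Ioo (-ρ) ρ) :
    |g u - u ^ 2 * (iteratedDeriv 2 g 0 / 2 + iteratedDeriv 3 g 0 / 6 * u)| ≤ M * |u| ^ 4 := by
  have := abs_sub_taylor_le 4 (h.contDiffOn_curve.of_le (by norm_num))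
    (h.curve_bound 4 (by norm_num)) hu
  simp only [Finset.sum_range_succ, Finset.sum_range_zero, iteratedDeriv_zero, iteratedDeriv_one,
    h.value_zero, h.deriv_zero, Nat.factorial] at this
  convert this using 2
  push_cast
  ring

theorem density_taylor (h : BoundedTangentData ρ M g m) {u : ℝ} (hu : u ∈ Ioo (-ρ) ρ) :
    |m u - (m 0 + deriv m 0 * u + iteratedDeriv 2 m 0 / 2 * u ^ 2 +
      iteratedDeriv 3 m 0 / 6 * u ^ 3)| ≤ M * |u| ^ 4 := by
  have := abs_sub_taylor_le 4 h.contDiffOn_density (h.density_bound 4 le_rfl) hu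
  simp only [Finset.sum_range_succ, Finset.sum_range_zero, iteratedDeriv_zero, iteratedDeriv_one,
    Nat.factorial] at this
  convert this using 2
  push_cast
  ring

/-- The function `u * g' u - g u` is the component of `x - y` along the (unnormalized) normal at `y`.
Its expansion starts at `u ^ 2`, and its coefficient of order `k` is `(k - 1) / k!` times the
derivative of `g`. -/
theorem normal_taylor (h : BoundedTangentData ρ M g m) {u : ℝ} (hu : u ∈ Ioo (-ρ) ρ) :
    |u * deriv g u - g u - u ^ 2 * (iteratedDeriv 2 g 0 / 2 + iteratedDeriv 3 g 0 / 3 * u +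
      iteratedDeriv 4 g 0 / 8 * u ^ 2 + iteratedDeriv 5 g 0 / 30 * u ^ 3)| ≤
      2 * M * |u| ^ 6 := by
  have h1 := (contDiffOn_succ_iff_deriv_of_isOpen (n := 5) isOpen_Ioo).1 h.contDiffOn_curve
  have hg := abs_sub_taylor_le 6 h.contDiffOn_curve (h.curve_bound 6 le_rfl) hu
  have hd := abs_sub_taylor_le (M := M) 5 h1.2.2 (fun v hv => by
    simpa [← iteratedDeriv_succ'] using h.curve_bound 6 le_rfl v hv) hu
  simp only [Finset.sum_range_succ, Finset.sum_range_zero, ← iteratedDeriv_succ',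
    Nat.factorial, iteratedDeriv_zero, zero_add, h.value_zero, h.deriv_zero,
    iteratedDeriv_one] at hg hd
  have hd' := mul_le_mul_of_nonneg_left hd (abs_nonneg u)
  rw [← abs_mul] at hd'
  calc _ ≤ _ := by
        refine le_trans (le_of_eq ?_) ((abs_sub _ _).trans (add_le_add hd' hg))
        congr 1
        push_cast
        ring
    _ = _ := by ring

theorem curve_continuousOn (h : BoundedTangentData ρ M g m) :
    ContinuousOn g (Ioo (-ρ) ρ) ∧ ContinuousOn (deriv g) (Ioo (-ρ) ρ) :=
  ⟨h.contDiffOn_curve.continuousOn,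
    ((contDiffOn_succ_iff_deriv_of_isOpen (n := 5) isOpen_Ioo).1
      h.contDiffOn_curve).2.2.continuousOn⟩

end BoundedTangentData

/-- The approximating polynomial with coefficients computed from the derivatives at `0`. -/
def dataPoly (g m : ℝ → ℝ) (t u : ℝ) : ℝ :=
  integrandPoly (iteratedDeriv 2 g 0 / 2) (iteratedDeriv 3 g 0 / 6) (iteratedDeriv 2 g 0 / 2)
    (iteratedDeriv 3 g 0 / 3) (iteratedDeriv 4 g 0 / 8) (iteratedDeriv 5 g 0 / 30) (m 0)
    (deriv m 0) (iteratedDeriv 2 m 0 / 2) (iteratedDeriv 3 m 0 / 6) t u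

/-- The family of all admissible data, times and parameters is taken as the index type, so that
boundedness of families yields a constant that depends on `ρ` and `M` only. -/
theorem integrand_near {ρ M : ℝ} (hρ : 0 < ρ) :
    ∃ C, 0 ≤ C ∧ ∀ g m, BoundedTangentData ρ M g m → ∀ t, 0 < t → ∀ u ∈ Ioo (-ρ) ρ,
      |(u * deriv g u - g u) * exp (-(g u ^ 2 / (4 * t))) * m u - dataPoly g m t u|
        ≤ C * (u ^ 6 + u ^ 8 / t + u ^ 10 / t ^ 2) := by
  have h0 : (0 : ℝ) ∈ Ioo (-ρ) ρ := ⟨by linarith, hρ⟩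
  -- all Taylor remainder coefficients are bounded over this index type
  let ι := {p : ((ℝ → ℝ) × (ℝ → ℝ)) × ℝ × ℝ //
    BoundedTangentData ρ M p.1.1 p.1.2 ∧ 0 < p.2.1 ∧ p.2.2 ∈ Ioo (-ρ) ρ}
  have bg : ∀ k ≤ 6, BddAbs fun i : ι => iteratedDeriv k i.1.1.1 0 :=
    fun k hk => ⟨M, fun i => i.2.1.curve_bound k hk 0 h0⟩
  have bm : ∀ k ≤ 4, BddAbs fun i : ι => iteratedDeriv k i.1.1.2 0 :=
    fun k hk => ⟨M, fun i => i.2.1.density_bound k hk 0 h0⟩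
  have hM : ∀ i : ι, 0 ≤ M := fun i => (abs_nonneg _).trans (i.2.1.curve_bound 0 (by norm_num) 0 h0)
  have bu : BddAbs fun i : ι => i.1.2.2 := ⟨ρ, fun i => (abs_lt.2 i.2.2.2).le⟩
  obtain ⟨C, hC0, hC⟩ := integrand_expansion (fun i : ι => i.2.2.1) bu
    ((bg 2 (by norm_num)).div_const 2) ((bg 3 (by norm_num)).div_const 6)
    ((bg 2 (by norm_num)).div_const 2) ((bg 3 (by norm_num)).div_const 3)
    ((bg 4 (by norm_num)).div_const 8) ((bg 5 (by norm_num)).div_const 30)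
    (bm 0 (by norm_num)) (bm 1 (by norm_num)) ((bm 2 (by norm_num)).div_const 2)
    ((bm 3 (by norm_num)).div_const 6)
    ⟨M, fun i => (exists_eq_mul_pow_of_abs_le (hM i) (i.2.1.curve_taylor i.2.2.2)).1⟩
    ⟨2 * M, fun i => (exists_eq_mul_pow_of_abs_le (by linarith [hM i])
      (i.2.1.normal_taylor i.2.2.2)).1⟩
    ⟨M, fun i => (exists_eq_mul_pow_of_abs_le (hM i) (i.2.1.density_taylor i.2.2.2)).1⟩
  refine ⟨C, hC0, fun g m h t ht u hu => ?_⟩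
  have hM' : 0 ≤ M := hM ⟨⟨⟨g, m⟩, t, u⟩, h, ht, hu⟩
  have := hC ⟨⟨⟨g, m⟩, t, u⟩, h, ht, hu⟩ (g u) (u * deriv g u - g u) (m u) ?_ ?_ ?_
  · simpa only [iteratedDeriv_zero, iteratedDeriv_one, dataPoly] using this
  · have := (exists_eq_mul_pow_of_abs_le hM' (h.curve_taylor hu)).2
    simp only
    linear_combination this
  · have := (exists_eq_mul_pow_of_abs_le (by linarith) (h.normal_taylor hu)).2
    simp only
    linear_combination this
  · have := (exists_eq_mul_pow_of_abs_le hM' (h.density_taylor hu)).2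
    simp only [iteratedDeriv_zero, iteratedDeriv_one]
    linear_combination this

/-- Extending the integral of `dataPoly` from `(-ρ, ρ)` to the line changes it only by an error of
the same size as the remainder. -/
theorem dataPoly_far {ρ M : ℝ} (hρ : 0 < ρ) :
    ∃ C, 0 ≤ C ∧ ∀ g m, BoundedTangentData ρ M g m → ∀ t, 0 < t → ∀ u, ρ ≤ |u| →
      |dataPoly g m t u| ≤ C * (u ^ 6 + u ^ 8 / t + u ^ 10 / t ^ 2) := by
  have h0 : (0 : ℝ) ∈ Ioo (-ρ) ρ := ⟨by linarith, hρ⟩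
  let ι := {p : (ℝ → ℝ) × (ℝ → ℝ) // BoundedTangentData ρ M p.1 p.2}
  have bg : ∀ k ≤ 6, BddAbs fun i : ι => iteratedDeriv k i.1.1 0 :=
    fun k hk => ⟨M, fun i => i.2.curve_bound k hk 0 h0⟩
  have bm : ∀ k ≤ 4, BddAbs fun i : ι => iteratedDeriv k i.1.2 0 :=
    fun k hk => ⟨M, fun i => i.2.density_bound k hk 0 h0⟩
  have a0 := (bg 2 (by norm_num)).div_const 2
  have a1 := (bg 3 (by norm_num)).div_const 6
  have b1 := (bg 3 (by norm_num)).div_const 3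
  have b2 := (bg 4 (by norm_num)).div_const 8
  have b3 := (bg 5 (by norm_num)).div_const 30
  have n0 := bm 0 (by norm_num)
  have n1 := bm 1 (by norm_num)
  have n2 := (bm 2 (by norm_num)).div_const 2
  have n3 := (bm 3 (by norm_num)).div_const 6
  simp only [iteratedDeriv_zero, iteratedDeriv_one] at n0 n1
  obtain ⟨K₂, h2⟩ := a0.mul n0
  obtain ⟨K₃, h3⟩ := (a0.mul n1).add (b1.mul n0)
  obtain ⟨K₄, h4⟩ := ((a0.mul n2).add (b1.mul n1)).add (b2.mul n0)
  obtain ⟨K₅, h5⟩ := (((a0.mul n3).add (b1.mul n2)).add (b2.mul n1)).add (b3.mul n0)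
  obtain ⟨K₆, h6⟩ := ((a0.pow 2).mul (a0.mul n0)).div_const 4
  obtain ⟨K₇, h7⟩ := (((a0.pow 2).mul ((a0.mul n1).add (b1.mul n0))).add
    ((((bddAbs_const 2).mul a0).mul a1).mul (a0.mul n0))).div_const 4
  have hs : ∀ {a K : ℝ}, a ≤ K → a ≤ |K| := fun h => h.trans (le_abs_self _)
  have p2 := abs_nonneg K₂
  have p3 := abs_nonneg K₃
  have p4 := abs_nonneg K₄
  have p5 := abs_nonneg K₅
  have p6 := abs_nonneg K₆
  have p7 := abs_nonneg K₇
  refine ⟨(|K₂| + |K₃| + |K₄| + |K₅| + |K₆| + |K₇|) *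
    (1 / ρ ^ 4 + 1 / ρ ^ 3 + 1 / ρ ^ 2 + 1 / ρ + 1 / ρ ^ 2 + 1 / ρ), by positivity,
    fun g m h t ht u hu => ?_⟩
  refine abs_poly_le_of_le_abs hρ ht hu ?_ ?_ ?_ ?_ ?_ ?_
  · linarith [hs (h2 ⟨⟨g, m⟩, h⟩)]
  · linarith [hs (h3 ⟨⟨g, m⟩, h⟩)]
  · linarith [hs (h4 ⟨⟨g, m⟩, h⟩)]
  · linarith [hs (h5 ⟨⟨g, m⟩, h⟩)]
  · linarith [hs (h6 ⟨⟨g, m⟩, h⟩)]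
  · linarith [hs (h7 ⟨⟨g, m⟩, h⟩)]

/-- The expansion of the boundary integral near the base point, in the tangent parametrization,
with an error that depends only on bounds for the derivatives of the data. -/
theorem tangent_integral_expansion {ρ M : ℝ} (hρ : 0 < ρ) :
    ∃ C, 0 ≤ C ∧ ∀ g m, BoundedTangentData ρ M g m → ∀ t, 0 < t →
      |(∫ u in Ioo (-ρ) ρ, (u * deriv g u - g u) / (8 * π * t ^ 2) *
          exp (-(u ^ 2 + g u ^ 2) / (4 * t)) * m u) -
        innerExpansion (iteratedDeriv 2 g 0) (iteratedDeriv 3 g 0) (iteratedDeriv 4 g 0)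
          (m 0) (deriv m 0) (iteratedDeriv 2 m 0) t| ≤ C * (t * √t) := by
  obtain ⟨C₁, hC1, near⟩ := integrand_near (M := M) hρ
  obtain ⟨C₂, hC2, far⟩ := dataPoly_far (M := M) hρ
  refine ⟨64080 * (C₁ + C₂) * √π / (8 * π), by positivity, fun g m h t ht => ?_⟩
  have hg := h.curve_continuousOn
  have hm := h.contDiffOn_density.continuousOn
  have hmain := abs_setIntegral_sub_integral_le (S := Ioo (-ρ) ρ) measurableSet_Ioo
    (f := fun u => (u * deriv g u - g u) * exp (-(g u ^ 2 / (4 * t))) * m u *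
      exp (-u ^ 2 / (4 * t)))
    (P := fun u => dataPoly g m t u * exp (-u ^ 2 / (4 * t)))
    (b := fun u => (C₁ + C₂) * (u ^ 6 + u ^ 8 / t + u ^ 10 / t ^ 2) * exp (-u ^ 2 / (4 * t)))
    ?_ ?_ (integrable_remainder_gaussian ht _) ?_ ?_
  · simp only [dataPoly, integrandPoly] at hmain
    rw [integral_remainder_gaussian ht, integral_poly_gaussian ht, gaussianMoment_two ht,
      gaussianMoment_four ht, gaussianMoment_six ht] at hmain
    have e1 : (∫ u in Ioo (-ρ) ρ, (u * deriv g u - g u) / (8 * π * t ^ 2) *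
          exp (-(u ^ 2 + g u ^ 2) / (4 * t)) * m u) =
        (1 / (8 * π * t ^ 2)) * ∫ u in Ioo (-ρ) ρ, (u * deriv g u - g u) *
          exp (-(g u ^ 2 / (4 * t))) * m u * exp (-u ^ 2 / (4 * t)) := by
      rw [← integral_const_mul]
      congr 1
      ext u
      rw [show -(u ^ 2 + g u ^ 2) / (4 * t) = -(g u ^ 2 / (4 * t)) + -u ^ 2 / (4 * t) by ring,
        exp_add]
      ring
    have hc : 0 < 1 / (8 * π * t ^ 2) := by positivity
    have := mul_le_mul_of_nonneg_left hmain hc.le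
    rw [← abs_of_pos hc, ← abs_mul, abs_of_pos hc, mul_sub, ← e1] at this
    rw [innerExpansion_eq ht] at this
    refine this.trans (le_of_eq ?_)
    field_simp
  · refine ContinuousOn.aestronglyMeasurable ?_ measurableSet_Ioo
    have := hg.1
    have := hg.2
    fun_prop
  · exact integrable_poly_gaussian ht _ _ _ _ _ _
  · intro u hu
    rw [← sub_mul, abs_mul, abs_of_pos (exp_pos _)]
    have n : 0 ≤ u ^ 6 + u ^ 8 / t + u ^ 10 / t ^ 2 := by positivity
    refine mul_le_mul_of_nonneg_right ((near g m h t ht u hu).trans ?_) (exp_pos _).le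
    nlinarith
  · intro u hu
    rw [abs_mul, abs_of_pos (exp_pos _)]
    have n : 0 ≤ u ^ 6 + u ^ 8 / t + u ^ 10 / t ^ 2 := by positivity
    have hu' : ρ ≤ |u| := by
      by_contra hlt
      exact hu (abs_lt.1 (not_le.1 hlt))
    refine mul_le_mul_of_nonneg_right ((far g m h t ht u hu').trans ?_) (exp_pos _).le
    nlinarith

/-! ### Arc length on a curve as one-dimensional Hausdorff measure -/

section AreaFormula

variable {E : Type*} [NormedAddCommGroup E] [MeasurableSpace E] [BorelSpace E]

variable {w v : ℝ → E} {J : Set ℝ} {K : ℝ≥0}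

/-- The length measure of the curve `w` on `J`, pulled back to the parameter line. -/
def curveMeasure (w : ℝ → E) (J : Set ℝ) : Measure ℝ :=
  Measure.map Subtype.val (Measure.comap (J.domRestrict w) (μH[1] : Measure E))

theorem curveMeasure_apply (hJ : MeasurableSet J) (hc : ContinuousOn w J) (hinj : InjOn w J)
    {A : Set ℝ} (hA : MeasurableSet A) : curveMeasure w J A = μH[1] (w '' (J ∩ A)) := by
  rw [curveMeasure, Measure.map_apply measurable_subtype_coe hA,
    (hc.measurableEmbedding hJ hinj).comap_apply, image_domRestrict, inter_comm]

variable [NormedSpace ℝ E]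

/-- Near a point of strict differentiability a curve is Lipschitz with constant `‖v‖ + ε` and
antilipschitz with constant `1 / (‖v‖ - ε)`, so the length of the image of a small ball is `‖v‖`
times the size of the ball, up to `ε`. The centre of the ball is the point itself, which is all
that differentiation of measures needs. -/
theorem eventually_hausdorffMeasure_image_le {w : ℝ → E} {v : E} {s ε : ℝ}
    (h : HasStrictDerivAt w v s) (hε : 0 < ε) :
    ∀ᶠ r in 𝓝[>] (0 : ℝ), μH[1] (w '' Metric.closedBall s r) ≤
        ENNReal.ofReal (‖v‖ + ε) * volume (Metric.closedBall s r) ∧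
      ENNReal.ofReal (‖v‖ - ε) * volume (Metric.closedBall s r) ≤
        μH[1] (w '' Metric.closedBall s r) := by
  have h1 := h.hasStrictFDerivAt.isLittleO.def hε
  obtain ⟨δ, hδ, hball⟩ := Metric.eventually_nhds_iff.1 h1
  have hlt : ∀ᶠ r in 𝓝[>] (0 : ℝ), r < δ :=
    mem_nhdsWithin_of_mem_nhds (Iio_mem_nhds hδ)
  filter_upwards [hlt] with r hr
  have key : ∀ p ∈ Metric.closedBall s r, ∀ q ∈ Metric.closedBall s r,
      ‖w p - w q - (p - q) • v‖ ≤ ε * |p - q| := by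
    intro p hp q hq
    have := @hball (p, q) (by
      rw [Prod.dist_eq]
      exact max_lt (lt_of_le_of_lt hp hr) (lt_of_le_of_lt hq hr))
    simpa using this
  constructor
  · have hlip : LipschitzOnWith (Real.toNNReal (‖v‖ + ε)) w (Metric.closedBall s r) := by
      refine LipschitzOnWith.of_dist_le_mul fun p hp q hq => ?_
      rw [Real.coe_toNNReal _ (by positivity), dist_eq_norm, Real.dist_eq]
      have h2 := norm_add_le (w p - w q - (p - q) • v) ((p - q) • v)
      rw [sub_add_cancel, norm_smul, Real.norm_eq_abs] at h2
      nlinarith [key p hp q hq]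
    have := hlip.hausdorffMeasure_image_le (d := 1) zero_le_one
    rwa [ENNReal.rpow_one, hausdorffMeasure_real] at this
  · rcases le_or_gt (‖v‖ - ε) 0 with hc | hc
    · rw [ENNReal.ofReal_of_nonpos hc, zero_mul]
      exact zero_le
    · have hanti : AntilipschitzWith (Real.toNNReal (‖v‖ - ε)⁻¹)
          ((Metric.closedBall s r).domRestrict w) := by
        refine AntilipschitzWith.of_le_mul_dist fun p q => ?_
        rw [Real.coe_toNNReal _ (by positivity), inv_mul_eq_div, le_div_iff₀ hc]
        rw [Subtype.dist_eq, Real.dist_eq, dist_eq_norm, domRestrict_apply, domRestrict_apply]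
        have h2 := norm_sub_norm_le (((p : ℝ) - q) • v) (((p : ℝ) - q) • v - (w p - w q))
        rw [sub_sub_cancel, norm_smul, Real.norm_eq_abs, norm_sub_rev] at h2
        nlinarith [key p p.2 q q.2]
      have h3 := hanti.le_hausdorffMeasure_image (d := 1) zero_le_one univ
      have h4 := isometry_subtype_coe (s := Metric.closedBall s r).hausdorffMeasure_image
        (d := 1) (Or.inl zero_le_one) univ
      rw [image_univ, Subtype.range_coe, hausdorffMeasure_real] at h4
      rw [← h4, image_univ, range_domRestrict, ENNReal.rpow_one] at h3
      calc _ ≤ ENNReal.ofReal (‖v‖ - ε) * (↑(Real.toNNReal (‖v‖ - ε)⁻¹) *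
            μH[1] (w '' Metric.closedBall s r)) := by gcongr
        _ = μH[1] (w '' Metric.closedBall s r) := by
          rw [← mul_assoc]
          change ENNReal.ofReal (‖v‖ - ε) * ENNReal.ofReal (‖v‖ - ε)⁻¹ * _ = _
          rw [← ENNReal.ofReal_mul hc.le, mul_inv_cancel₀ hc.ne', ENNReal.ofReal_one, one_mul]

/-- The length measure has density `‖v‖`: it is absolutely continuous because the curve is
Lipschitz, and its Radon-Nikodym derivative is the limit of the ratios over shrinking balls. -/
theorem curveMeasure_eq_withDensity (hJ : IsOpen J) (hJfin : volume J ≠ ⊤)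
    (hd : ∀ s ∈ J, HasStrictDerivAt w (v s) s) (hlip : LipschitzOnWith K w J)
    (hinj : InjOn w J) :
    curveMeasure w J = (volume.restrict J).withDensity fun s => ENNReal.ofReal ‖v s‖ := by
  have happ := fun {A : Set ℝ} (hA : MeasurableSet A) =>
    curveMeasure_apply hJ.measurableSet hlip.continuousOn hinj hA
  have hle : ∀ A, MeasurableSet A → curveMeasure w J A ≤ K * volume (J ∩ A) := by
    intro A hA
    rw [happ hA]
    have := (hlip.mono inter_subset_left).hausdorffMeasure_image_le (s := J ∩ A) (d := 1)
      zero_le_one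
    rwa [ENNReal.rpow_one, hausdorffMeasure_real] at this
  have : IsFiniteMeasure (curveMeasure w J) := by
    refine ⟨(hle univ MeasurableSet.univ).trans_lt ?_⟩
    rw [inter_univ]
    exact ENNReal.mul_lt_top ENNReal.coe_lt_top hJfin.lt_top
  have hac : curveMeasure w J ≪ volume := by
    refine Measure.AbsolutelyContinuous.mk fun A hA h0 => ?_
    refine le_antisymm ((hle A hA).trans ?_) zero_le
    rw [measure_mono_null inter_subset_right h0, mul_zero]
  have hrn : ∀ᵐ s ∂(volume.restrict J),
      (curveMeasure w J).rnDeriv volume s = ENNReal.ofReal ‖v s‖ := by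
    filter_upwards [ae_restrict_of_ae (Besicovitch.ae_tendsto_rnDeriv (curveMeasure w J) volume),
      ae_restrict_mem hJ.measurableSet] with s hs hsJ
    have hsub : ∀ᶠ r in 𝓝[>] (0 : ℝ), Metric.closedBall s r ⊆ J := by
      obtain ⟨δ, hδ, hb⟩ := Metric.isOpen_iff.1 hJ s hsJ
      filter_upwards [mem_nhdsWithin_of_mem_nhds (Iio_mem_nhds hδ)] with r hr
      exact (Metric.closedBall_subset_ball hr).trans hb
    have hbounds : ∀ ε, 0 < ε → (curveMeasure w J).rnDeriv volume s ≤ ENNReal.ofReal (‖v s‖ + ε) ∧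
        ENNReal.ofReal (‖v s‖ - ε) ≤ (curveMeasure w J).rnDeriv volume s := by
      intro ε hε
      have hev : ∀ᶠ r in 𝓝[>] (0 : ℝ),
          curveMeasure w J (Metric.closedBall s r) / volume (Metric.closedBall s r) ≤
            ENNReal.ofReal (‖v s‖ + ε) ∧ ENNReal.ofReal (‖v s‖ - ε) ≤
          curveMeasure w J (Metric.closedBall s r) / volume (Metric.closedBall s r) := by
        filter_upwards [hsub, eventually_hausdorffMeasure_image_le (hd s hsJ) hε,
          self_mem_nhdsWithin] with r hr hb hr0
        rw [happ Metric.isClosed_closedBall.measurableSet, inter_eq_right.2 hr]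
        have hv0 : volume (Metric.closedBall s r) ≠ 0 := by
          rw [Real.volume_closedBall]
          simpa using hr0
        have hvt : volume (Metric.closedBall s r) ≠ ⊤ := by
          rw [Real.volume_closedBall]
          exact ENNReal.ofReal_ne_top
        exact ⟨ENNReal.div_le_of_le_mul hb.1,
          (ENNReal.le_div_iff_mul_le (Or.inl hv0) (Or.inl hvt)).2 hb.2⟩
      exact ⟨le_of_tendsto hs (hev.mono fun _ h => h.1), ge_of_tendsto hs (hev.mono fun _ h => h.2)⟩
    have hlim : ∀ σ : ℝ, Tendsto (fun ε : ℝ => ENNReal.ofReal (‖v s‖ + σ * ε)) (𝓝[>] 0)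
        (𝓝 (ENNReal.ofReal ‖v s‖)) := by
      intro σ
      have hc : Continuous fun ε : ℝ => ENNReal.ofReal (‖v s‖ + σ * ε) :=
        ENNReal.continuous_ofReal.comp (by fun_prop)
      have := (hc.tendsto 0).mono_left (nhdsWithin_le_nhds (s := Ioi 0))
      simpa using this
    -- let `ε` tend to `0` in both bounds
    refine le_antisymm (ge_of_tendsto (hlim 1) ?_) (le_of_tendsto (hlim (-1)) ?_)
    · filter_upwards [self_mem_nhdsWithin] with ε hε
      simpa using (hbounds ε hε).1
    · filter_upwards [self_mem_nhdsWithin] with ε hε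
      simpa [← sub_eq_add_neg] using (hbounds ε hε).2
  have hres : curveMeasure w J = (curveMeasure w J).restrict J := by
    refine (Measure.restrict_eq_self_of_ae_mem ?_).symm
    rw [ae_iff]
    change curveMeasure w J Jᶜ = 0
    rw [happ hJ.measurableSet.compl]
    simp
  rw [hres]
  conv_lhs => rw [← Measure.withDensity_rnDeriv_eq _ _ hac]
  rw [restrict_withDensity hJ.measurableSet]
  exact withDensity_congr_ae hrn

/-- The integral over a regular curve with respect to one-dimensional Hausdorff measure is the
integral over the parameter with respect to arc length. -/
theorem setIntegral_image_hausdorffMeasure (hJ : IsOpen J) (hJfin : volume J ≠ ⊤)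
    (hd : ∀ s ∈ J, HasStrictDerivAt w (v s) s) (hv : ContinuousOn v J)
    (hlip : LipschitzOnWith K w J) (hinj : InjOn w J) (f : E → ℝ) :
    ∫ y in w '' J, f y ∂μH[1] = ∫ s in J, ‖v s‖ * f (w s) := by
  have hemb := hlip.continuousOn.measurableEmbedding hJ.measurableSet hinj
  have h1 : (μH[1] : Measure E).restrict (w '' J) =
      Measure.map (J.domRestrict w) (Measure.comap (J.domRestrict w) μH[1]) := by
    rw [hemb.map_comap, range_domRestrict]
  have hval : MeasurableEmbedding (Subtype.val : J → ℝ) :=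
    MeasurableEmbedding.subtype_coe hJ.measurableSet
  have h2 := hval.integral_map (μ := Measure.comap (J.domRestrict w) (μH[1] : Measure E))
    (fun s => f (w s))
  change ∫ s, f (w s) ∂(curveMeasure w J) = _ at h2
  rw [h1, hemb.integral_map]
  change ∫ s : J, f (w s) ∂_ = _
  rw [← h2, curveMeasure_eq_withDensity hJ hJfin hd hlip hinj,
    integral_withDensity_eq_integral_toReal_smul₀]
  · simp
  · exact (hv.norm.aestronglyMeasurable hJ.measurableSet).aemeasurable.ennreal_ofReal
  · exact Filter.Eventually.of_forall fun _ => ENNReal.ofReal_lt_top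

end AreaFormula

/-! ### Orthonormal frames and graph boxes -/

section Frame

variable {τ n : Plane}

/-- Two orthonormal vectors of the plane span it. -/
theorem eq_smul_add_smul_of_orthonormal (hτ : ‖τ‖ = 1) (hn : ‖n‖ = 1) (h : inner ℝ τ n = 0)
    (p : Plane) : p = inner ℝ τ p • τ + inner ℝ n p • n := by
  have ho : Orthonormal ℝ ![τ, n] := by
    rw [orthonormal_iff_ite]
    intro i j
    fin_cases i <;> fin_cases j <;> simp [hτ, hn, h, real_inner_comm]
  have hc : Fintype.card (Fin 2) = Module.finrank ℝ Plane := by simp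
  let B := OrthonormalBasis.mk ho (by
    have := (basisOfOrthonormalOfCardEqFinrank ho hc).span_eq
    rw [coe_basisOfOrthonormalOfCardEqFinrank] at this
    exact this.ge)
  have := B.sum_repr' p
  simpa [B, Fin.sum_univ_two] using this.symm

theorem inner_framePoint_tangent (hτ : ‖τ‖ = 1) (h : inner ℝ τ n = 0) (b : Plane) (ξ η : ℝ) :
    inner ℝ τ (framePoint b τ n ξ η - b) = ξ := by
  rw [framePoint, show b + ξ • τ + η • n - b = ξ • τ + η • n by abel, inner_add_right,
    inner_smul_right, inner_smul_right, h, real_inner_self_eq_norm_sq, hτ]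
  ring

theorem inner_framePoint_normal (hn : ‖n‖ = 1) (h : inner ℝ τ n = 0) (b : Plane) (ξ η : ℝ) :
    inner ℝ n (framePoint b τ n ξ η - b) = η := by
  rw [framePoint, show b + ξ • τ + η • n - b = ξ • τ + η • n by abel, inner_add_right,
    inner_smul_right, inner_smul_right, real_inner_comm, h, real_inner_self_eq_norm_sq, hn]
  ring

theorem framePoint_inner (hτ : ‖τ‖ = 1) (hn : ‖n‖ = 1) (h : inner ℝ τ n = 0) (b p : Plane) :
    framePoint b τ n (inner ℝ τ (p - b)) (inner ℝ n (p - b)) = p := by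
  have := eq_smul_add_smul_of_orthonormal hτ hn h (p - b)
  rw [framePoint, add_assoc, ← this]
  abel

theorem norm_smul_add_smul_sq (hτ : ‖τ‖ = 1) (hn : ‖n‖ = 1) (h : inner ℝ τ n = 0) (ξ η : ℝ) :
    ‖ξ • τ + η • n‖ ^ 2 = ξ ^ 2 + η ^ 2 := by
  rw [← real_inner_self_eq_norm_sq, inner_add_left, inner_add_right, inner_add_right]
  simp only [inner_smul_left, inner_smul_right, real_inner_self_eq_norm_sq, hτ, hn, h,
    real_inner_comm τ n]
  simp
  ring

theorem norm_framePoint_sub_sq (hτ : ‖τ‖ = 1) (hn : ‖n‖ = 1) (h : inner ℝ τ n = 0) (b : Plane)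
    (ξ η : ℝ) : ‖framePoint b τ n ξ η - b‖ ^ 2 = ξ ^ 2 + η ^ 2 := by
  rw [framePoint, show b + ξ • τ + η • n - b = ξ • τ + η • n by abel,
    norm_smul_add_smul_sq hτ hn h]

end Frame

/-- The graph representation at `b` holds in the explicit box `|ξ| < r`, `|η| < R`, which contains
the graph over `(-r, r)`, and the slope of the graph is at most `1 / 2` there. -/
structure IsGraphBox (Ω : Set Plane) (b τ n : Plane) (γ : ℝ → ℝ) (r R : ℝ) : Prop
    extends IsTangentGraph Ω b τ n γ where
  radius_pos : 0 < r
  contDiffOn : ContDiffOn ℝ ∞ γ (Ioo (-r) r)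
  abs_lt : ∀ ξ ∈ Ioo (-r) r, |γ ξ| < R
  slope_le : ∀ ξ ∈ Ioo (-r) r, |deriv γ ξ| ≤ 1 / 2
  mem_iff : ∀ ξ η : ℝ, ξ ∈ Ioo (-r) r → |η| < R → (framePoint b τ n ξ η ∈ Ω ↔ η < γ ξ)

/-- The graph of a tangent graph stays in the given square, and is nearly flat, over a smaller
interval. -/
theorem IsTangentGraph.exists_isGraphBox {Ω : Set Plane} {b τ n : Plane} {γ : ℝ → ℝ}
    (h : IsTangentGraph Ω b τ n γ) : ∃ r R, IsGraphBox Ω b τ n γ r R := by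
  obtain ⟨r, hr, hs, hm⟩ := h.local_graph
  have h0 : Ioo (-r) r ∈ 𝓝 (0 : ℝ) := Ioo_mem_nhds (by linarith) hr
  have hc : ContinuousAt γ 0 := hs.continuousOn.continuousAt h0
  have hs' := (contDiffOn_infty_iff_deriv_of_isOpen isOpen_Ioo).1 hs
  have hd : ContinuousAt (deriv γ) 0 := hs'.2.continuousOn.continuousAt h0
  have e1 : ∀ᶠ ξ in 𝓝 (0 : ℝ), |γ ξ| < r := by
    have := hc.abs
    rw [ContinuousAt, h.value_zero, abs_zero] at this
    exact this.eventually_lt_const hr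
  have e2 : ∀ᶠ ξ in 𝓝 (0 : ℝ), |deriv γ ξ| < 1 / 2 := by
    have := hd.abs
    rw [ContinuousAt, h.deriv_zero, abs_zero] at this
    exact this.eventually_lt_const (by norm_num)
  obtain ⟨ε, hε, hball⟩ := Metric.eventually_nhds_iff.1 (e1.and (e2.and h0))
  have hb : ∀ ξ ∈ Ioo (-ε) ε, |γ ξ| < r ∧ |deriv γ ξ| < 1 / 2 ∧ ξ ∈ Ioo (-r) r := by
    intro ξ hξ
    exact hball (by rw [Real.dist_eq, sub_zero]; exact _root_.abs_lt.2 hξ)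
  exact ⟨ε, r, { h with
    radius_pos := hε
    contDiffOn := hs.mono fun ξ hξ => (hb ξ hξ).2.2
    abs_lt := fun ξ hξ => (hb ξ hξ).1
    slope_le := fun ξ hξ => (hb ξ hξ).2.1.le
    mem_iff := fun ξ η hξ hη => hm ξ η (_root_.abs_lt.2 (hb ξ hξ).2.2) hη }⟩

/-- A tangent graph stays one when the tangent direction is reversed. -/
theorem IsTangentGraph.reflect {Ω : Set Plane} {b τ n : Plane} {γ : ℝ → ℝ}
    (h : IsTangentGraph Ω b τ n γ) : IsTangentGraph Ω b (-τ) n (fun ξ => γ (-ξ)) := by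
  obtain ⟨r, hr, hs, hm⟩ := h.local_graph
  refine ⟨by rw [norm_neg, h.norm_tangent], h.norm_normal, by rw [inner_neg_left, h.inner_eq_zero,
    neg_zero], by rw [neg_zero, h.value_zero], by
      rw [deriv_comp_neg, neg_zero, h.deriv_zero, neg_zero], r, hr, ?_, ?_⟩
  · refine hs.comp contDiff_neg.contDiffOn fun ξ hξ => ?_
    exact ⟨by linarith [hξ.2], by linarith [hξ.1]⟩
  · intro ξ η hξ hη
    rw [← hm (-ξ) η (by rwa [abs_neg]) hη, framePoint, framePoint, smul_neg, neg_smul]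

namespace IsGraphBox

variable {Ω : Set Plane} {b τ n : Plane} {γ : ℝ → ℝ} {r R : ℝ}

theorem continuousAt_graph (h : IsGraphBox Ω b τ n γ r R) {a : ℝ} (ha : a ∈ Ioo (-r) r) :
    ContinuousAt γ a :=
  h.contDiffOn.continuousOn.continuousAt (isOpen_Ioo.mem_nhds ha)

theorem contDiffAt_graph (h : IsGraphBox Ω b τ n γ r R) {a : ℝ} (ha : a ∈ Ioo (-r) r) :
    ContDiffAt ℝ ∞ γ a :=
  h.contDiffOn.contDiffAt (isOpen_Ioo.mem_nhds ha)

theorem contDiffAt_deriv (h : IsGraphBox Ω b τ n γ r R) {a : ℝ} (ha : a ∈ Ioo (-r) r) :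
    ContDiffAt ℝ ∞ (deriv γ) a :=
  ((contDiffOn_infty_iff_deriv_of_isOpen isOpen_Ioo).1 h.contDiffOn).2.contDiffAt
    (isOpen_Ioo.mem_nhds ha)

theorem hasDerivAt_graph (h : IsGraphBox Ω b τ n γ r R) {a : ℝ} (ha : a ∈ Ioo (-r) r) :
    HasDerivAt γ (deriv γ a) a :=
  ((h.contDiffAt_graph ha).differentiableAt (by simp)).hasDerivAt

theorem zero_mem (h : IsGraphBox Ω b τ n γ r R) : (0 : ℝ) ∈ Ioo (-r) r :=
  ⟨by linarith [h.radius_pos], h.radius_pos⟩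

/-- The part of the boundary in the box is the graph. -/
theorem mem_frontier_iff (h : IsGraphBox Ω b τ n γ r R) (hΩ : IsOpen Ω) {ξ η : ℝ}
    (hξ : ξ ∈ Ioo (-r) r) (hη : |η| < R) :
    framePoint b τ n ξ η ∈ frontier Ω ↔ η = γ ξ := by
  rw [hΩ.frontier_eq, Set.mem_sdiff, h.mem_iff ξ η hξ hη, not_lt]
  constructor
  · rintro ⟨hcl, hle⟩
    by_contra hne
    have hlt : γ ξ < η := lt_of_le_of_ne hle (Ne.symm hne)
    have hX : ContinuousAt (fun p : Plane => inner ℝ τ (p - b)) (framePoint b τ n ξ η) := by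
      fun_prop
    have hY : ContinuousAt (fun p : Plane => inner ℝ n (p - b)) (framePoint b τ n ξ η) := by
      fun_prop
    have eX := inner_framePoint_tangent h.norm_tangent h.inner_eq_zero b ξ η
    have eY := inner_framePoint_normal h.norm_normal h.inner_eq_zero b ξ η
    have c1 : ∀ᶠ p in 𝓝 (framePoint b τ n ξ η), inner ℝ τ (p - b) ∈ Ioo (-r) r :=
      hX.eventually_mem (isOpen_Ioo.mem_nhds (by rwa [eX]))
    have c2 : ∀ᶠ p in 𝓝 (framePoint b τ n ξ η), |inner ℝ n (p - b)| < R :=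
      hY.abs.eventually_lt_const (by simpa only [eY] using hη)
    have hγ : ContinuousAt γ (inner ℝ τ (framePoint b τ n ξ η - b)) := by
      rw [eX]
      exact h.continuousAt_graph hξ
    have c3 : ∀ᶠ p in 𝓝 (framePoint b τ n ξ η),
        γ (inner ℝ τ (p - b)) < inner ℝ n (p - b) :=
      (hγ.comp_of_eq hX rfl).eventually_lt hY (by simpa [eX, eY] using hlt)
    obtain ⟨p, ⟨p1, p2, p3⟩, hp⟩ := mem_closure_iff_nhds.1 hcl _ (c1.and (c2.and c3))
    rw [← framePoint_inner h.norm_tangent h.norm_normal h.inner_eq_zero b p,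
      h.mem_iff _ _ p1 p2] at hp
    exact absurd hp (not_lt.2 p3.le)
  · rintro rfl
    refine ⟨?_, le_rfl⟩
    have ht : Tendsto (fun v : ℝ => framePoint b τ n ξ v) (𝓝[<] γ ξ)
        (𝓝 (framePoint b τ n ξ (γ ξ))) := by
      have hc : Continuous fun v : ℝ => framePoint b τ n ξ v := by
        unfold framePoint
        fun_prop
      exact (hc.tendsto _).mono_left nhdsWithin_le_nhds
    refine mem_closure_of_tendsto ht ?_
    have : ∀ᶠ v in 𝓝 (γ ξ), |v| < R :=
      continuous_abs.continuousAt.eventually_lt_const (h.abs_lt ξ hξ)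
    filter_upwards [self_mem_nhdsWithin, mem_nhdsWithin_of_mem_nhds this] with v hv hv'
    exact (h.mem_iff ξ v hξ hv').2 hv

theorem curve_mem_frontier (h : IsGraphBox Ω b τ n γ r R) (hΩ : IsOpen Ω) {a : ℝ}
    (ha : a ∈ Ioo (-r) r) : framePoint b τ n a (γ a) ∈ frontier Ω :=
  (h.mem_frontier_iff hΩ ha (h.abs_lt a ha)).2 rfl

/-- A boundary point whose coordinates lie in the box is on the graph. -/
theorem eq_curve_of_mem_frontier (h : IsGraphBox Ω b τ n γ r R) (hΩ : IsOpen Ω) {p : Plane}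
    (hp : p ∈ frontier Ω) (h1 : inner ℝ τ (p - b) ∈ Ioo (-r) r) (h2 : |inner ℝ n (p - b)| < R) :
    inner ℝ n (p - b) = γ (inner ℝ τ (p - b)) ∧
      p = framePoint b τ n (inner ℝ τ (p - b)) (γ (inner ℝ τ (p - b))) := by
  have e := framePoint_inner h.norm_tangent h.norm_normal h.inner_eq_zero b p
  have := (h.mem_frontier_iff hΩ h1 h2).1 (by rwa [e])
  exact ⟨this, by rw [← this, e]⟩

theorem R_pos (h : IsGraphBox Ω b τ n γ r R) : 0 < R :=
  (abs_nonneg _).trans_lt (h.abs_lt 0 h.zero_mem)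

/-- The box, as a neighbourhood of each point of the graph. -/
theorem eventually_mem_box (h : IsGraphBox Ω b τ n γ r R) {a : ℝ} (ha : a ∈ Ioo (-r) r) :
    ∀ᶠ p in 𝓝 (framePoint b τ n a (γ a)),
      inner ℝ τ (p - b) ∈ Ioo (-r) r ∧ |inner ℝ n (p - b)| < R := by
  have hX : ContinuousAt (fun p : Plane => inner ℝ τ (p - b)) (framePoint b τ n a (γ a)) := by
    fun_prop
  have hY : ContinuousAt (fun p : Plane => inner ℝ n (p - b)) (framePoint b τ n a (γ a)) := by
    fun_prop
  refine (hX.eventually_mem (isOpen_Ioo.mem_nhds ?_)).and (hY.abs.eventually_lt_const ?_)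
  · rwa [inner_framePoint_tangent h.norm_tangent h.inner_eq_zero]
  · simpa only [inner_framePoint_normal h.norm_normal h.inner_eq_zero] using h.abs_lt a ha

end IsGraphBox

theorem hasStrictDerivAt_framePoint {b τ n : Plane} {g : ℝ → ℝ} {g' u : ℝ}
    (hg : HasStrictDerivAt g g' u) :
    HasStrictDerivAt (fun u => framePoint b τ n u (g u)) (τ + g' • n) u := by
  unfold framePoint
  have := (((hasStrictDerivAt_id u).smul_const τ).const_add b).fun_add (hg.smul_const n)
  simpa using this

theorem hasDerivAt_framePoint {b τ n : Plane} {g : ℝ → ℝ} {g' u : ℝ} (hg : HasDerivAt g g' u) :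
    HasDerivAt (fun u => framePoint b τ n u (g u)) (τ + g' • n) u := by
  unfold framePoint
  have := (((hasDerivAt_id u).smul_const τ).const_add b).fun_add (hg.smul_const n)
  simpa using this

theorem lipschitzOnWith_framePoint {b τ n : Plane} (hτ : ‖τ‖ = 1) (hn : ‖n‖ = 1) {g : ℝ → ℝ}
    {ρ : ℝ} (hd : ∀ u ∈ Ioo (-ρ) ρ, HasDerivAt g (deriv g u) u)
    (hb : ∀ u ∈ Ioo (-ρ) ρ, |deriv g u| ≤ 1) :
    LipschitzOnWith 2 (fun u => framePoint b τ n u (g u)) (Ioo (-ρ) ρ) := by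
  refine Convex.lipschitzOnWith_of_nnnorm_hasDerivWithin_le (convex_Ioo _ _)
    (fun u hu => (hasDerivAt_framePoint (hd u hu)).hasDerivWithinAt) fun u hu => ?_
  rw [← NNReal.coe_le_coe, coe_nnnorm]
  refine (norm_add_le _ _).trans ?_
  rw [norm_smul, hτ, hn, Real.norm_eq_abs, mul_one]
  have := hb u hu
  push_cast
  linarith

theorem framePoint_zero (b τ n : Plane) : framePoint b τ n 0 0 = b := by
  simp [framePoint]

theorem HasDerivAt.nonneg_of_neg_left {ψ : ℝ → ℝ} {d : ℝ} (hd : HasDerivAt ψ d 0) (h0 : ψ 0 = 0)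
    (hneg : ∀ᶠ v in 𝓝[<] (0 : ℝ), ψ v < 0) : 0 ≤ d := by
  have h := hd.tendsto_slope_zero_left
  refine ge_of_tendsto h ?_
  filter_upwards [hneg, self_mem_nhdsWithin] with v hv hv0
  rw [zero_add, h0, sub_zero, smul_eq_mul]
  exact mul_nonneg_of_nonpos_of_nonpos (inv_nonpos.2 (le_of_lt hv0)) hv.le

namespace IsGraphBox

variable {Ω : Set Plane} {b τ n : Plane} {γ : ℝ → ℝ} {r R : ℝ}

theorem inner_curve_framePoint_tangent (h : IsGraphBox Ω b τ n γ r R) (a : ℝ) (τ' n' : Plane)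
    (u v : ℝ) : inner ℝ τ (framePoint (framePoint b τ n a (γ a)) τ' n' u v - b) =
      a + u * inner ℝ τ τ' + v * inner ℝ τ n' := by
  have := inner_framePoint_tangent h.norm_tangent h.inner_eq_zero b a (γ a)
  rw [framePoint, show framePoint b τ n a (γ a) + u • τ' + v • n' - b =
    (framePoint b τ n a (γ a) - b) + u • τ' + v • n' by abel, inner_add_right, inner_add_right,
    this, inner_smul_right, inner_smul_right]

theorem inner_curve_framePoint_normal (h : IsGraphBox Ω b τ n γ r R) (a : ℝ) (τ' n' : Plane)
    (u v : ℝ) : inner ℝ n (framePoint (framePoint b τ n a (γ a)) τ' n' u v - b) =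
      γ a + u * inner ℝ n τ' + v * inner ℝ n n' := by
  have := inner_framePoint_normal h.norm_normal h.inner_eq_zero b a (γ a)
  rw [framePoint, show framePoint b τ n a (γ a) + u • τ' + v • n' - b =
    (framePoint b τ n a (γ a) - b) + u • τ' + v • n' by abel, inner_add_right, inner_add_right,
    this, inner_smul_right, inner_smul_right]

/-- Near a point of the graph, any tangent graph at this point lies on the given graph. -/
theorem eventually_tangentGraph_mem (h : IsGraphBox Ω b τ n γ r R) (hΩ : IsOpen Ω) {a : ℝ}
    (ha : a ∈ Ioo (-r) r) {τ' n' : Plane} {γ' : ℝ → ℝ}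
    (h' : IsTangentGraph Ω (framePoint b τ n a (γ a)) τ' n' γ') :
    ∀ᶠ u in 𝓝 (0 : ℝ), γ a + u * inner ℝ n τ' + γ' u * inner ℝ n n' =
      γ (a + u * inner ℝ τ τ' + γ' u * inner ℝ τ n') := by
  obtain ⟨r', R', hb⟩ := h'.exists_isGraphBox
  have hc : ContinuousAt (fun u => framePoint (framePoint b τ n a (γ a)) τ' n' u (γ' u)) 0 := by
    have := hb.continuousAt_graph hb.zero_mem
    unfold framePoint
    fun_prop
  have hbox := h.eventually_mem_box ha
  have e0 : framePoint (framePoint b τ n a (γ a)) τ' n' 0 (γ' 0) = framePoint b τ n a (γ a) := by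
    rw [h'.value_zero, framePoint_zero]
  have hin := hc.tendsto.eventually (by rwa [e0])
  filter_upwards [hin, isOpen_Ioo.mem_nhds hb.zero_mem] with u hu hu'
  have := (h.eq_curve_of_mem_frontier hΩ (hb.curve_mem_frontier hΩ hu') hu.1 hu.2).1
  rwa [h.inner_curve_framePoint_tangent, h.inner_curve_framePoint_normal] at this

/-- The frame of a tangent graph is determined by the boundary, up to the orientation of the
tangent. -/
theorem frame_unique (h : IsGraphBox Ω b τ n γ r R) (hΩ : IsOpen Ω) {a : ℝ}
    (ha : a ∈ Ioo (-r) r) {τ' n' : Plane} {γ' : ℝ → ℝ}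
    (h' : IsTangentGraph Ω (framePoint b τ n a (γ a)) τ' n' γ') :
    inner ℝ n τ' = deriv γ a * inner ℝ τ τ' ∧ inner ℝ τ τ' ^ 2 * (1 + deriv γ a ^ 2) = 1 ∧
      inner ℝ n n' = 1 / √(1 + deriv γ a ^ 2) ∧
      inner ℝ τ n' = -deriv γ a / √(1 + deriv γ a ^ 2) := by
  have hev := h.eventually_tangentGraph_mem hΩ ha h'
  obtain ⟨r', R', hb⟩ := h'.exists_isGraphBox
  have dτ := eq_smul_add_smul_of_orthonormal h.norm_tangent h.norm_normal h.inner_eq_zero τ'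
  have dn := eq_smul_add_smul_of_orthonormal h.norm_tangent h.norm_normal h.inner_eq_zero n'
  have n1 := norm_smul_add_smul_sq h.norm_tangent h.norm_normal h.inner_eq_zero
    (inner ℝ τ τ') (inner ℝ n τ')
  have n2 := norm_smul_add_smul_sq h.norm_tangent h.norm_normal h.inner_eq_zero
    (inner ℝ τ n') (inner ℝ n n')
  rw [← dτ, h'.norm_tangent] at n1
  rw [← dn, h'.norm_normal] at n2
  have n3 : inner ℝ τ τ' * inner ℝ τ n' + inner ℝ n τ' * inner ℝ n n' = 0 := by
    have e := h'.inner_eq_zero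
    rw [dτ, inner_add_left, inner_smul_left, inner_smul_left] at e
    simpa using e
  have hγ := h.hasDerivAt_graph ha
  have hγ' : HasDerivAt γ' 0 0 := by
    have := hb.hasDerivAt_graph hb.zero_mem
    rwa [h'.deriv_zero] at this
  -- points slightly below the base point on the normal line lie in `Ω`, hence below the given graph
  have hside : ∀ᶠ v in 𝓝[<] (0 : ℝ), γ a + v * inner ℝ n n' - γ (a + v * inner ℝ τ n') < 0 := by
    have hc : ContinuousAt (fun v : ℝ => framePoint (framePoint b τ n a (γ a)) τ' n' 0 v) 0 := by
      unfold framePoint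
      fun_prop
    have e0 := framePoint_zero (framePoint b τ n a (γ a)) τ' n'
    have hin := hc.tendsto.eventually (by rw [e0]; exact h.eventually_mem_box ha)
    have hR : ∀ᶠ v in 𝓝 (0 : ℝ), |v| < R' :=
      continuous_abs.continuousAt.eventually_lt_const (by rw [abs_zero]; exact hb.R_pos)
    filter_upwards [mem_nhdsWithin_of_mem_nhds hin, mem_nhdsWithin_of_mem_nhds hR,
      self_mem_nhdsWithin] with v hv hvR hv0
    have hmem := (hb.mem_iff 0 v hb.zero_mem hvR).2 (by rw [h'.value_zero]; exact hv0)
    rw [← framePoint_inner h.norm_tangent h.norm_normal h.inner_eq_zero b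
      (framePoint (framePoint b τ n a (γ a)) τ' n' 0 v), h.mem_iff _ _ hv.1 hv.2,
      h.inner_curve_framePoint_tangent, h.inner_curve_framePoint_normal] at hmem
    simp only [zero_mul, add_zero] at hmem
    linarith
  generalize inner ℝ τ τ' = c at *
  generalize inner ℝ n τ' = d at *
  generalize inner ℝ τ n' = e at *
  generalize inner ℝ n n' = f at *
  generalize hk : deriv γ a = k at *
  -- both graphs describe the boundary, so their tangent lines agree
  have hd : d = k * c := by
    have l : HasDerivAt (fun u => γ a + u * d + γ' u * f) (d + 0 * f) 0 := by
      have := (((hasDerivAt_id (0 : ℝ)).mul_const d).const_add (γ a)).fun_add (hγ'.mul_const f)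
      simpa using this
    have l2 : HasDerivAt (fun u => a + u * c + γ' u * e) c 0 := by
      have := (((hasDerivAt_id (0 : ℝ)).mul_const c).const_add a).fun_add (hγ'.mul_const e)
      simpa using this
    have l3 : HasDerivAt (fun u => γ (a + u * c + γ' u * e)) (k * c) 0 := by
      refine HasDerivAt.comp (h₂ := γ) 0 ?_ l2
      simpa [h'.value_zero] using hγ
    have := l.unique (l3.congr_of_eventuallyEq hev)
    linarith
  have hc2 : c ^ 2 * (1 + k ^ 2) = 1 := by
    rw [hd] at n1
    linarith
  have hc0 : c ≠ 0 := by
    rintro rfl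
    norm_num at hc2
  have he : e = -k * f := by
    have : c * (e + k * f) = 0 := by rw [hd] at n3; linarith
    have := (mul_eq_zero.1 this).resolve_left hc0
    linarith
  have hf2 : f ^ 2 * (1 + k ^ 2) = 1 := by
    rw [he] at n2
    linarith
  -- the side condition excludes the inward normal
  have hf : 0 ≤ f := by
    have l : HasDerivAt (fun v => γ a + v * f - γ (a + v * e)) (f - k * e) 0 := by
      have l1 := ((hasDerivAt_id (0 : ℝ)).mul_const f).const_add (γ a)
      have l2 := ((hasDerivAt_id (0 : ℝ)).mul_const e).const_add a
      have l3 : HasDerivAt (fun v => γ (a + v * e)) (k * e) 0 := by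
        refine HasDerivAt.comp (h₂ := γ) 0 ?_ (by simpa using l2)
        simpa using hγ
      have := l1.fun_sub l3
      simpa using this
    have := l.nonneg_of_neg_left (by simp) hside
    rw [he] at this
    have h1 : 0 ≤ f * (1 + k ^ 2) := by linarith
    exact nonneg_of_mul_nonneg_left h1 (by positivity)
  have hq : 0 < √(1 + k ^ 2) := sqrt_pos.2 (by positivity)
  have hf' : f = 1 / √(1 + k ^ 2) := by
    rw [eq_div_iff hq.ne']
    have : (f * √(1 + k ^ 2)) ^ 2 = 1 := by
      rw [mul_pow, sq_sqrt (by positivity), hf2]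
    exact (pow_eq_one_iff_of_nonneg (mul_nonneg hf hq.le) two_ne_zero).1 this
  exact ⟨hd, hc2, hf', by rw [he, hf']; ring⟩

/-- The unit normal of the graph, in the frame of the box. -/
theorem outwardNormal_curve (h : IsGraphBox Ω b τ n γ r R) (hΩ : IsOpen Ω)
    (hs : HasSmoothBoundary Ω) {a : ℝ} (ha : a ∈ Ioo (-r) r) :
    outwardNormal Ω (framePoint b τ n a (γ a)) =
      (1 / √(1 + deriv γ a ^ 2)) • (n - deriv γ a • τ) := by
  have hex : ∃ n', IsOutwardNormal Ω (framePoint b τ n a (γ a)) n' := by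
    obtain ⟨τ', n', γ', h'⟩ := hs _ (h.curve_mem_frontier hΩ ha)
    exact ⟨n', τ', γ', h'⟩
  rw [outwardNormal, dif_pos hex]
  obtain ⟨τ', γ', h'⟩ := hex.choose_spec
  obtain ⟨-, -, h1, h2⟩ := h.frame_unique hΩ ha h'
  rw [eq_smul_add_smul_of_orthonormal h.norm_tangent h.norm_normal h.inner_eq_zero hex.choose,
    h1, h2]
  module

theorem lipschitzOnWith_curve (h : IsGraphBox Ω b τ n γ r R) :
    LipschitzOnWith 2 (fun s => framePoint b τ n s (γ s)) (Ioo (-r) r) := by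
  refine lipschitzOnWith_framePoint h.norm_tangent h.norm_normal
    (fun s hs => h.hasDerivAt_graph hs) fun s hs => (h.slope_le s hs).trans (by norm_num)

/-- Near the centre of a box, the boundary is contained in the graph. -/
theorem eventually_mem_curve (h : IsGraphBox Ω b τ n γ r R) (hΩ : IsOpen Ω) :
    ∀ᶠ p in 𝓝[frontier Ω] b, inner ℝ τ (p - b) ∈ Ioo (-r) r ∧
      p = framePoint b τ n (inner ℝ τ (p - b)) (γ (inner ℝ τ (p - b))) := by
  have hbox := h.eventually_mem_box h.zero_mem
  rw [h.value_zero, framePoint_zero] at hbox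
  filter_upwards [self_mem_nhdsWithin, mem_nhdsWithin_of_mem_nhds hbox] with p hp hp'
  exact ⟨hp'.1, (h.eq_curve_of_mem_frontier hΩ hp hp'.1 hp'.2).2⟩

/-- The boundary has finite length near the centre of a box, being part of a Lipschitz curve. -/
theorem finiteAtFilter (h : IsGraphBox Ω b τ n γ r R) (hΩ : IsOpen Ω) :
    (μH[1] : Measure Plane).FiniteAtFilter (𝓝[frontier Ω] b) := by
  refine ⟨_, h.eventually_mem_curve hΩ, (measure_mono (t :=
    (fun s => framePoint b τ n s (γ s)) '' Ioo (-r) r) ?_).trans_lt ?_⟩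
  · rintro p ⟨h1, h2⟩
    exact ⟨_, h1, h2.symm⟩
  · have := h.lipschitzOnWith_curve.hausdorffMeasure_image_le (d := 1) zero_le_one
    rw [ENNReal.rpow_one, hausdorffMeasure_real, Real.volume_Ioo] at this
    exact this.trans_lt (ENNReal.mul_lt_top ENNReal.coe_lt_top ENNReal.ofReal_lt_top)

theorem continuousWithinAt_outwardNormal (h : IsGraphBox Ω b τ n γ r R) (hΩ : IsOpen Ω)
    (hs : HasSmoothBoundary Ω) : ContinuousWithinAt (outwardNormal Ω) (frontier Ω) b := by
  have hb : b ∈ frontier Ω := by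
    have := h.curve_mem_frontier hΩ h.zero_mem
    rwa [h.value_zero, framePoint_zero] at this
  have hev : ∀ᶠ p in 𝓝[frontier Ω] b, outwardNormal Ω p =
      (1 / √(1 + deriv γ (inner ℝ τ (p - b)) ^ 2)) • (n - deriv γ (inner ℝ τ (p - b)) • τ) := by
    filter_upwards [h.eventually_mem_curve hΩ] with p hp
    conv_lhs => rw [hp.2]
    exact h.outwardNormal_curve hΩ hs hp.1
  refine ContinuousWithinAt.congr_of_eventuallyEq ?_ hev (hev.self_of_nhdsWithin hb)
  refine ContinuousAt.continuousWithinAt ?_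
  have hd : ContinuousAt (deriv γ) 0 := (h.contDiffAt_deriv h.zero_mem).continuousAt
  have hX : ContinuousAt (fun p : Plane => inner ℝ τ (p - b)) b := by fun_prop
  have hc : ContinuousAt (fun p : Plane => deriv γ (inner ℝ τ (p - b))) b :=
    hd.comp_of_eq hX (by simp)
  have hq : ∀ p : Plane, √(1 + deriv γ (inner ℝ τ (p - b)) ^ 2) ≠ 0 := fun p =>
    (sqrt_pos.2 (by positivity)).ne'
  have hden : ContinuousAt (fun p : Plane => 1 / √(1 + deriv γ (inner ℝ τ (p - b)) ^ 2)) b :=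
    continuousAt_const.div (continuousAt_const.add (hc.pow 2)).sqrt (hq b)
  exact hden.smul (continuousAt_const.sub (hc.smul continuousAt_const))

end IsGraphBox

theorem hausdorffMeasure_frontier_lt_top {Ω : Set Plane} (hΩ : IsOpen Ω)
    (hcompact : IsCompact (frontier Ω)) (hs : HasSmoothBoundary Ω) :
    μH[1] (frontier Ω) < ⊤ := by
  refine hcompact.measure_lt_top_of_nhdsWithin fun b hb => ?_
  obtain ⟨τ, n, γ, h⟩ := hs b hb
  obtain ⟨r, R, hbox⟩ := h.exists_isGraphBox
  exact hbox.finiteAtFilter hΩ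

theorem continuousOn_outwardNormal {Ω : Set Plane} (hΩ : IsOpen Ω) (hs : HasSmoothBoundary Ω) :
    ContinuousOn (outwardNormal Ω) (frontier Ω) := by
  intro b hb
  obtain ⟨τ, n, γ, h⟩ := hs b hb
  obtain ⟨r, R, hbox⟩ := h.exists_isGraphBox
  exact hbox.continuousWithinAt_outwardNormal hΩ hs

/-- The bound also covers the junk value `0` off the smooth boundary. -/
theorem norm_outwardNormal {Ω : Set Plane} {y : Plane} : ‖outwardNormal Ω y‖ ≤ 1 := by
  rw [outwardNormal]
  split_ifs with h
  · obtain ⟨τ, γ, h'⟩ := h.choose_spec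
    exact h'.norm_normal.le
  · simp

/-! ### Tangent coordinates along a graph, smooth in the base point -/

/-- A neighbourhood of the origin of the plane contains an open square. -/
theorem eventually_prod_Ioo {P : ℝ × ℝ → Prop} (h : ∀ᶠ p in 𝓝 ((0 : ℝ), (0 : ℝ)), P p) :
    ∃ ρ > 0, ∀ a ∈ Ioo (-ρ) ρ, ∀ u ∈ Ioo (-ρ) ρ, P (a, u) := by
  obtain ⟨ε, hε, hb⟩ := Metric.eventually_nhds_iff.1 h
  refine ⟨ε, hε, fun a ha u hu => hb ?_⟩
  rw [Prod.dist_eq, Real.dist_eq, Real.dist_eq, sub_zero, sub_zero]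
  exact max_lt (abs_lt.2 ha) (abs_lt.2 hu)

/-- A function of two variables that is smooth near the origin has uniformly bounded partial
derivatives in the second variable. -/
theorem exists_uniform_partial_bounds (n : ℕ) {f : ℝ × ℝ → ℝ} (hf : ContDiffAt ℝ n f (0, 0)) :
    ∃ ρ > 0, ∃ M, ∀ a ∈ Ioo (-ρ) ρ, ContDiffOn ℝ n (fun u => f (a, u)) (Ioo (-ρ) ρ) ∧
      ∀ k ≤ n, ∀ u ∈ Ioo (-ρ) ρ, |iteratedDeriv k (fun u => f (a, u)) u| ≤ M := by
  have hbd : ∃ M, ∀ᶠ p in 𝓝 ((0 : ℝ), (0 : ℝ)), |f p| ≤ M := by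
    refine ⟨|f (0, 0)| + 1, ?_⟩
    exact (hf.continuousAt.abs.eventually_lt_const (lt_add_one _)).mono fun _ h => h.le
  obtain ⟨M₀, hM0⟩ := hbd
  induction n generalizing f M₀ with
  | zero =>
    obtain ⟨U, hU, hc⟩ := contDiffAt_zero.1 hf
    obtain ⟨ρ, hρ, h⟩ := eventually_prod_Ioo (hM0.and hU)
    refine ⟨ρ, hρ, M₀, fun a ha => ⟨?_, fun k hk u hu => ?_⟩⟩
    · refine contDiffOn_zero.2 (hc.comp (by fun_prop) fun u hu => (h a ha u hu).2)
    · obtain rfl : k = 0 := by omega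
      simpa using (h a ha u hu).1
  | succ n ih =>
    have hd : ContDiffAt ℝ n (fun p => fderiv ℝ f p (0, 1)) (0, 0) :=
      (hf.fderiv_right (m := n) (by norm_cast)).clm_apply contDiffAt_const
    have hdb := (hd.continuousAt.abs.eventually_lt_const (lt_add_one _)).mono fun _ h => h.le
    obtain ⟨ρ₁, hρ1, M₁, h1⟩ := ih hd _ hdb
    have hdiff : ∀ᶠ p in 𝓝 ((0 : ℝ), (0 : ℝ)), DifferentiableAt ℝ f p :=
      (hf.eventually (by simp)).mono fun p hp => hp.differentiableAt (by simp)
    obtain ⟨ρ₂, hρ2, h2⟩ := eventually_prod_Ioo (hM0.and hdiff)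
    have hρ : 0 < min ρ₁ ρ₂ := lt_min hρ1 hρ2
    have s1 : Ioo (-min ρ₁ ρ₂) (min ρ₁ ρ₂) ⊆ Ioo (-ρ₁) ρ₁ :=
      Ioo_subset_Ioo (neg_le_neg (min_le_left _ _)) (min_le_left _ _)
    have s2 : Ioo (-min ρ₁ ρ₂) (min ρ₁ ρ₂) ⊆ Ioo (-ρ₂) ρ₂ :=
      Ioo_subset_Ioo (neg_le_neg (min_le_right _ _)) (min_le_right _ _)
    refine ⟨min ρ₁ ρ₂, hρ, max M₀ M₁, fun a ha => ?_⟩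
    have hder : ∀ u ∈ Ioo (-min ρ₁ ρ₂) (min ρ₁ ρ₂),
        HasDerivAt (fun u => f (a, u)) (fderiv ℝ f (a, u) (0, 1)) u := fun u hu =>
      (h2 a (s2 ha) u (s2 hu)).2.hasFDerivAt.comp_hasDerivAt u
        ((hasDerivAt_const u a).prodMk (hasDerivAt_id u))
    have hderiv : EqOn (deriv fun u => f (a, u)) (fun u => fderiv ℝ f (a, u) (0, 1))
        (Ioo (-min ρ₁ ρ₂) (min ρ₁ ρ₂)) := fun u hu => (hder u hu).deriv
    obtain ⟨c1, b1⟩ := h1 a (s1 ha)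
    constructor
    · push_cast
      rw [contDiffOn_succ_iff_deriv_of_isOpen isOpen_Ioo]
      refine ⟨fun u hu => (hder u hu).differentiableAt.differentiableWithinAt, by simp, ?_⟩
      exact (c1.mono s1).congr hderiv
    · intro k hk u hu
      rcases k with _ | k
      · simpa using (h2 a (s2 ha) u (s2 hu)).1.trans (le_max_left _ _)
      · rw [iteratedDeriv_succ', (hderiv.eventuallyEq_of_mem
          (isOpen_Ioo.mem_nhds hu)).iteratedDeriv_eq]
        exact (b1 k (by omega) u (s1 hu)).trans (le_max_right _ _)

/-- The tangential coordinate, relative to the frame at the point `(a, γ a)` of the graph of `γ`,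
of the point of the graph with abscissa `a + h`. -/
def tangentCoord (γ : ℝ → ℝ) (p : ℝ × ℝ) : ℝ :=
  (p.2 + deriv γ p.1 * (γ (p.1 + p.2) - γ p.1)) / √(1 + deriv γ p.1 ^ 2)

/-- The normal coordinate of the same point. -/
def normalCoord (γ : ℝ → ℝ) (p : ℝ × ℝ) : ℝ :=
  (γ (p.1 + p.2) - γ p.1 - deriv γ p.1 * p.2) / √(1 + deriv γ p.1 ^ 2)

section Coords

variable {γ : ℝ → ℝ}

theorem contDiffAt_tangentCoord (hγ : ContDiffAt ℝ ∞ γ 0) (hγ' : ContDiffAt ℝ ∞ (deriv γ) 0) :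
    ContDiffAt ℝ ∞ (tangentCoord γ) (0, 0) ∧ ContDiffAt ℝ ∞ (normalCoord γ) (0, 0) := by
  have f1 : ContDiffAt ℝ ∞ (fun p : ℝ × ℝ => γ p.1) (0, 0) := hγ.comp (0, 0) contDiffAt_fst
  have f2 : ContDiffAt ℝ ∞ (fun p : ℝ × ℝ => deriv γ p.1) (0, 0) := hγ'.comp (0, 0) contDiffAt_fst
  have f3 : ContDiffAt ℝ ∞ (fun p : ℝ × ℝ => γ (p.1 + p.2)) (0, 0) :=
    ContDiffAt.comp (0, 0) (g := γ) (by simpa using hγ) (contDiffAt_fst.add contDiffAt_snd)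
  have f4 : ContDiffAt ℝ ∞ (fun p : ℝ × ℝ => √(1 + deriv γ p.1 ^ 2)) (0, 0) :=
    (contDiffAt_const.add (f2.pow 2)).sqrt (by positivity)
  have h0 : √(1 + deriv γ ((0 : ℝ), (0 : ℝ)).1 ^ 2) ≠ 0 := (sqrt_pos.2 (by positivity)).ne'
  exact ⟨(contDiffAt_snd.add (f2.mul (f3.sub f1))).div f4 h0,
    ((f3.sub f1).sub (f2.mul contDiffAt_snd)).div f4 h0⟩

/-- The derivative at the origin is computed from the two restrictions `tangentCoord γ (a, 0) = 0` and
`tangentCoord γ (0, h) = h`, the latter because the slope vanishes at `0`. -/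
theorem hasFDerivAt_tangentCoord (hγ : ContDiffAt ℝ ∞ γ 0) (hγ' : ContDiffAt ℝ ∞ (deriv γ) 0)
    (h0 : deriv γ 0 = 0) :
    HasFDerivAt (tangentCoord γ) (ContinuousLinearMap.snd ℝ ℝ ℝ) (0, 0) := by
  have hd := ((contDiffAt_tangentCoord hγ hγ').1.differentiableAt (by simp)).hasFDerivAt
  have e1 : HasDerivAt (fun a : ℝ => tangentCoord γ (a, 0))
      (fderiv ℝ (tangentCoord γ) (0, 0) (1, 0)) 0 :=
    HasFDerivAt.comp_hasDerivAt (f := fun a : ℝ => (a, (0 : ℝ))) 0 hd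
      ((hasDerivAt_id 0).prodMk (hasDerivAt_const 0 0))
  have e2 : HasDerivAt (fun h : ℝ => tangentCoord γ (0, h))
      (fderiv ℝ (tangentCoord γ) (0, 0) (0, 1)) 0 :=
    HasFDerivAt.comp_hasDerivAt (f := fun h : ℝ => ((0 : ℝ), h)) 0 hd
      ((hasDerivAt_const 0 0).prodMk (hasDerivAt_id 0))
  have e1' : HasDerivAt (fun a : ℝ => tangentCoord γ (a, 0)) 0 0 := by
    simpa [tangentCoord] using hasDerivAt_const (0 : ℝ) (0 : ℝ)
  have e2' : HasDerivAt (fun h : ℝ => tangentCoord γ (0, h)) 1 0 := by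
    simpa [tangentCoord, h0] using hasDerivAt_id' (0 : ℝ)
  have v1 := e1.unique e1'
  have v2 := e2.unique e2'
  refine hd.congr_fderiv (ContinuousLinearMap.prod_ext ?_ ?_)
  · ext
    simp [v1]
  · ext
    simp [v2]

/-- The tangential coordinate can be used as a parameter on the graph, uniformly in the base point:
the inverse function theorem for `(a, h) ↦ (a, tangentCoord γ (a, h))`. -/
theorem exists_inverse_tangentCoord (hγ : ContDiffAt ℝ ∞ γ 0)
    (hγ' : ContDiffAt ℝ ∞ (deriv γ) 0) (h0 : deriv γ 0 = 0) {ε : ℝ} (hε : 0 < ε) :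
    ∃ H : ℝ × ℝ → ℝ, ContDiffAt ℝ ∞ H (0, 0) ∧ H (0, 0) = 0 ∧ ∃ ρ > 0,
      (∀ a ∈ Ioo (-ρ) ρ, ∀ u ∈ Ioo (-ρ) ρ,
        H (a, u) ∈ Ioo (-ε) ε ∧ tangentCoord γ (a, H (a, u)) = u) ∧
      ∀ a ∈ Ioo (-ρ) ρ, ∀ h ∈ Ioo (-ρ) ρ, H (a, tangentCoord γ (a, h)) = h := by
  have hc : ContDiffAt ℝ ∞ (fun p : ℝ × ℝ => (p.1, tangentCoord γ p)) (0, 0) :=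
    contDiffAt_fst.prodMk (contDiffAt_tangentCoord hγ hγ').1
  have hF : HasFDerivAt (fun p : ℝ × ℝ => (p.1, tangentCoord γ p))
      ((ContinuousLinearEquiv.refl ℝ (ℝ × ℝ) : (ℝ × ℝ) ≃L[ℝ] (ℝ × ℝ)) : (ℝ × ℝ) →L[ℝ] (ℝ × ℝ))
      (0, 0) := by
    have := (hasFDerivAt_fst (𝕜 := ℝ) (p := ((0 : ℝ), (0 : ℝ)))).prodMk
      (hasFDerivAt_tangentCoord hγ hγ' h0)
    exact this.congr_fderiv rfl
  have hn : (∞ : ℕ∞ω) ≠ 0 := by simp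
  let e := hc.toOpenPartialHomeomorph _ hF hn
  have hs : ((0 : ℝ), (0 : ℝ)) ∈ e.source := hc.mem_toOpenPartialHomeomorph_source hF hn
  have ec : ∀ p, e p = (p.1, tangentCoord γ p) := fun _ => rfl
  have e0 : e (0, 0) = (0, 0) := by simp [ec, tangentCoord]
  have ht : ((0 : ℝ), (0 : ℝ)) ∈ e.target := by
    have := e.map_source hs
    rwa [e0] at this
  have hsymm0 : e.symm (0, 0) = (0, 0) := by
    have := e.left_inv hs
    rwa [e0] at this
  have hsm : ContDiffAt ℝ ∞ e.symm (0, 0) := by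
    refine e.contDiffAt_symm ht (f₀' := ContinuousLinearEquiv.refl ℝ (ℝ × ℝ)) ?_ ?_
    · rw [hsymm0]
      exact hF
    · rw [hsymm0]
      exact hc
  have hH : ContDiffAt ℝ ∞ (fun p => (e.symm p).2) (0, 0) := hsm.snd
  have hH0 : (e.symm (0, 0)).2 = 0 := by rw [hsymm0]
  have ev1 : ∀ᶠ p in 𝓝 ((0 : ℝ), (0 : ℝ)), (e.symm p).2 ∈ Ioo (-ε) ε :=
    hH.continuousAt.eventually_mem (isOpen_Ioo.mem_nhds (by rw [hH0]; exact ⟨by linarith, hε⟩))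
  have ev2 : ∀ᶠ p in 𝓝 ((0 : ℝ), (0 : ℝ)), p ∈ e.target := e.open_target.mem_nhds ht
  have ev3 : ∀ᶠ p in 𝓝 ((0 : ℝ), (0 : ℝ)), p ∈ e.source := e.open_source.mem_nhds hs
  obtain ⟨ρ, hρ, h⟩ := eventually_prod_Ioo (ev1.and (ev2.and ev3))
  refine ⟨fun p => (e.symm p).2, hH, hH0, ρ, hρ, fun a ha u hu => ?_, fun a ha v hv => ?_⟩
  · obtain ⟨m1, m2, -⟩ := h a ha u hu
    refine ⟨m1, ?_⟩
    have hr := e.right_inv m2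
    rw [ec, Prod.mk.injEq] at hr
    have : (a, (e.symm (a, u)).2) = e.symm (a, u) := Prod.ext hr.1.symm rfl
    rw [this]
    exact hr.2
  · obtain ⟨-, -, m3⟩ := h a ha v hv
    have hl := e.left_inv m3
    rw [ec] at hl
    simp only at hl ⊢
    rw [hl]

end Coords

/-! ### Tangent charts with uniform derivative bounds -/

/-- The tangent graph `γ` at `x` extends to a graph `g` on the whole interval `(-ρ, ρ)`, which
covers the boundary in the ball of radius `c` around `x` and satisfies, together with the density
`μ` along it, the derivative bounds `M`. -/
structure IsUniformChart (Ω : Set Plane) (μ : Plane → ℝ) (x τ n : Plane) (γ : ℝ → ℝ)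
    (ρ M c : ℝ) (g : ℝ → ℝ) : Prop where
  data : BoundedTangentData ρ M g (fun u => μ (framePoint x τ n u (g u)))
  germ : g =ᶠ[𝓝 0] γ
  slope_le : ∀ u ∈ Ioo (-ρ) ρ, |deriv g u| ≤ 1
  mem_frontier : ∀ u ∈ Ioo (-ρ) ρ, framePoint x τ n u (g u) ∈ frontier Ω
  normal_eq : ∀ u ∈ Ioo (-ρ) ρ, √(1 + deriv g u ^ 2) • outwardNormal Ω (framePoint x τ n u (g u)) =
    n - deriv g u • τ
  cover : frontier Ω ∩ Metric.ball x c ⊆ (fun u => framePoint x τ n u (g u)) '' Ioo (-ρ) ρ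

/-- The slope vanishes at the origin, so the bound for the second derivative controls it. -/
theorem BoundedTangentData.slope_le {ρ M : ℝ} {g m : ℝ → ℝ} (h : BoundedTangentData ρ M g m)
    {u : ℝ} (hu : u ∈ Ioo (-ρ) ρ) : |deriv g u| ≤ M * |u| := by
  have h1 := (contDiffOn_succ_iff_deriv_of_isOpen (n := 5) isOpen_Ioo).1 h.contDiffOn_curve
  have := abs_sub_taylor_le (M := M) 1 (h1.2.2.of_le (by norm_num)) (fun v hv => by
    simpa [← iteratedDeriv_succ'] using h.curve_bound 2 (by norm_num) v hv) hu
  simpa [h.deriv_zero] using this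

namespace IsGraphBox

variable {Ω : Set Plane} {b τ₀ n₀ : Plane} {γ₀ : ℝ → ℝ} {r R : ℝ}

/-- The frame of a tangent graph at a point of the box, for the orientation of the box. -/
theorem frame_eq (h : IsGraphBox Ω b τ₀ n₀ γ₀ r R) (hΩ : IsOpen Ω) {a : ℝ}
    (ha : a ∈ Ioo (-r) r) {τ n : Plane} {γ : ℝ → ℝ}
    (h' : IsTangentGraph Ω (framePoint b τ₀ n₀ a (γ₀ a)) τ n γ) (hpos : 0 < inner ℝ τ₀ τ) :
    inner ℝ τ₀ τ = 1 / √(1 + deriv γ₀ a ^ 2) ∧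
    inner ℝ n₀ τ = deriv γ₀ a / √(1 + deriv γ₀ a ^ 2) ∧
    inner ℝ n₀ n = 1 / √(1 + deriv γ₀ a ^ 2) ∧
    inner ℝ τ₀ n = -deriv γ₀ a / √(1 + deriv γ₀ a ^ 2) ∧
    τ = (1 / √(1 + deriv γ₀ a ^ 2)) • (τ₀ + deriv γ₀ a • n₀) ∧
    n = (1 / √(1 + deriv γ₀ a ^ 2)) • (n₀ - deriv γ₀ a • τ₀) := by
  obtain ⟨h1, h2, h3, h4⟩ := h.frame_unique hΩ ha h'
  have dτ := eq_smul_add_smul_of_orthonormal h.norm_tangent h.norm_normal h.inner_eq_zero τ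
  have dn := eq_smul_add_smul_of_orthonormal h.norm_tangent h.norm_normal h.inner_eq_zero n
  have hq : 0 < √(1 + deriv γ₀ a ^ 2) := sqrt_pos.2 (by positivity)
  have hc : inner ℝ τ₀ τ = 1 / √(1 + deriv γ₀ a ^ 2) := by
    rw [eq_div_iff hq.ne']
    have : (inner ℝ τ₀ τ * √(1 + deriv γ₀ a ^ 2)) ^ 2 = 1 := by
      rw [mul_pow, sq_sqrt (by positivity), h2]
    exact (pow_eq_one_iff_of_nonneg (mul_nonneg hpos.le hq.le) two_ne_zero).1 this
  have hd : inner ℝ n₀ τ = deriv γ₀ a / √(1 + deriv γ₀ a ^ 2) := by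
    rw [h1, hc]
    ring
  refine ⟨hc, hd, h3, h4, ?_, ?_⟩
  · conv_lhs => rw [dτ, hc, hd]
    module
  · conv_lhs => rw [dn, h3, h4]
    module

/-- A point of the graph of the box, expressed in the frame at another point of the graph. -/
theorem framePoint_coords {a : ℝ} {τ n : Plane}
    (hτ : τ = (1 / √(1 + deriv γ₀ a ^ 2)) • (τ₀ + deriv γ₀ a • n₀))
    (hn : n = (1 / √(1 + deriv γ₀ a ^ 2)) • (n₀ - deriv γ₀ a • τ₀)) (t : ℝ) :
    framePoint (framePoint b τ₀ n₀ a (γ₀ a)) τ n (tangentCoord γ₀ (a, t))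
      (normalCoord γ₀ (a, t)) = framePoint b τ₀ n₀ (a + t) (γ₀ (a + t)) := by
  have hq : 0 < √(1 + deriv γ₀ a ^ 2) := sqrt_pos.2 (by positivity)
  have hq2 : √(1 + deriv γ₀ a ^ 2) ^ 2 = 1 + deriv γ₀ a ^ 2 := sq_sqrt (by positivity)
  simp only [framePoint, tangentCoord, normalCoord, hτ, hn]
  generalize √(1 + deriv γ₀ a ^ 2) = q at *
  generalize deriv γ₀ a = k at *
  generalize γ₀ (a + t) = y
  generalize γ₀ a = x
  have e1 : (t + k * (y - x)) / q * (1 / q) - (y - x - k * t) / q * (1 / q) * k = t := by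
    field_simp
    linear_combination (-t) * hq2
  have e2 : (t + k * (y - x)) / q * (1 / q) * k + (y - x - k * t) / q * (1 / q) = y - x := by
    field_simp
    linear_combination (-(y - x)) * hq2
  calc _ = b + a • τ₀ + x • n₀ +
        ((t + k * (y - x)) / q * (1 / q) - (y - x - k * t) / q * (1 / q) * k) • τ₀ +
        ((t + k * (y - x)) / q * (1 / q) * k + (y - x - k * t) / q * (1 / q)) • n₀ := by module
    _ = _ := by
      rw [e1, e2]
      module

/-- The graph over the tangent line at `(a, γ₀ a)`, obtained by solving for the parameter, has the
same germ as any tangent graph there. -/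
theorem germ_eq (h : IsGraphBox Ω b τ₀ n₀ γ₀ r R) (hΩ : IsOpen Ω) {a : ℝ}
    (ha : a ∈ Ioo (-r) r) {τ n : Plane} {γ : ℝ → ℝ}
    (h' : IsTangentGraph Ω (framePoint b τ₀ n₀ a (γ₀ a)) τ n γ) (hpos : 0 < inner ℝ τ₀ τ)
    {H : ℝ × ℝ → ℝ} {ρ : ℝ} (hρ : 0 < ρ)
    (hH : ∀ t ∈ Ioo (-ρ) ρ, H (a, tangentCoord γ₀ (a, t)) = t) :
    (fun u => normalCoord γ₀ (a, H (a, u))) =ᶠ[𝓝 0] γ := by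
  obtain ⟨hc, hd, hf, he, -, -⟩ := h.frame_eq hΩ ha h' hpos
  have hev := h.eventually_tangentGraph_mem hΩ ha h'
  obtain ⟨r', R', hb⟩ := h'.exists_isGraphBox
  have hsmall : ∀ᶠ u in 𝓝 (0 : ℝ), u * inner ℝ τ₀ τ + γ u * inner ℝ τ₀ n ∈ Ioo (-ρ) ρ := by
    have hcont : ContinuousAt (fun u => u * inner ℝ τ₀ τ + γ u * inner ℝ τ₀ n) 0 := by
      have := hb.continuousAt_graph hb.zero_mem
      fun_prop
    refine hcont.eventually_mem (isOpen_Ioo.mem_nhds ?_)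
    rw [h'.value_zero, zero_mul, zero_mul, zero_add]
    exact ⟨by linarith, hρ⟩
  have hq : 0 < √(1 + deriv γ₀ a ^ 2) := sqrt_pos.2 (by positivity)
  have hq2 : √(1 + deriv γ₀ a ^ 2) ^ 2 = 1 + deriv γ₀ a ^ 2 := sq_sqrt (by positivity)
  filter_upwards [hev, hsmall] with u hu hu'
  have ht := hH _ hu'
  rw [hc, he] at ht
  rw [hc, hd, hf, he, add_assoc a] at hu
  have e1 : tangentCoord γ₀ (a, u * (1 / √(1 + deriv γ₀ a ^ 2)) +
      γ u * (-deriv γ₀ a / √(1 + deriv γ₀ a ^ 2))) = u := by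
    simp only [tangentCoord]
    rw [← hu]
    field_simp
    linear_combination (-u) * hq2
  rw [e1] at ht
  simp only [ht, normalCoord]
  rw [← hu]
  field_simp
  linear_combination (-γ u) * hq2

/-- The normal of the graph over the tangent line at `(a, γ₀ a)`. -/
theorem normal_eq_of_graph (h : IsGraphBox Ω b τ₀ n₀ γ₀ r R) (hΩ : IsOpen Ω)
    (hs : HasSmoothBoundary Ω) {a : ℝ} (ha : a ∈ Ioo (-r) r) {τ n : Plane} {γ : ℝ → ℝ}
    (h' : IsTangentGraph Ω (framePoint b τ₀ n₀ a (γ₀ a)) τ n γ) (hpos : 0 < inner ℝ τ₀ τ)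
    {g : ℝ → ℝ} {u g' s : ℝ} (hg : HasDerivAt g g' u) (hg' : |g'| ≤ 1) (hsr : s ∈ Ioo (-r) r)
    (hsu : framePoint (framePoint b τ₀ n₀ a (γ₀ a)) τ n u (g u) = framePoint b τ₀ n₀ s (γ₀ s))
    (hgraph : ∀ᶠ v in 𝓝 u, ∃ s', framePoint (framePoint b τ₀ n₀ a (γ₀ a)) τ n v (g v) =
      framePoint b τ₀ n₀ s' (γ₀ s')) :
    √(1 + g' ^ 2) • outwardNormal Ω (framePoint (framePoint b τ₀ n₀ a (γ₀ a)) τ n u (g u)) =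
      n - g' • τ := by
  obtain ⟨hc, hd, hf, he, hτ, hn⟩ := h.frame_eq hΩ ha h' hpos
  have hk := h.slope_le a ha
  have X := fun v => h.inner_curve_framePoint_tangent a τ n v (g v)
  have Y := fun v => h.inner_curve_framePoint_normal a τ n v (g v)
  have hS : a + u * inner ℝ τ₀ τ + g u * inner ℝ τ₀ n = s := by
    rw [← X, hsu, inner_framePoint_tangent h.norm_tangent h.inner_eq_zero]
  have hev : (fun v => γ₀ a + v * inner ℝ n₀ τ + g v * inner ℝ n₀ n) =ᶠ[𝓝 u]
      fun v => γ₀ (a + v * inner ℝ τ₀ τ + g v * inner ℝ τ₀ n) := by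
    filter_upwards [hgraph] with v ⟨s', hv⟩
    rw [← X, ← Y, hv, inner_framePoint_tangent h.norm_tangent h.inner_eq_zero,
      inner_framePoint_normal h.norm_normal h.inner_eq_zero]
  have l : HasDerivAt (fun v => γ₀ a + v * inner ℝ n₀ τ + g v * inner ℝ n₀ n)
      (inner ℝ n₀ τ + g' * inner ℝ n₀ n) u := by
    have := (((hasDerivAt_id u).mul_const (inner ℝ n₀ τ)).const_add (γ₀ a)).fun_add
      (hg.mul_const (inner ℝ n₀ n))
    simpa using this
  have l2 : HasDerivAt (fun v => a + v * inner ℝ τ₀ τ + g v * inner ℝ τ₀ n)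
      (inner ℝ τ₀ τ + g' * inner ℝ τ₀ n) u := by
    have := (((hasDerivAt_id u).mul_const (inner ℝ τ₀ τ)).const_add a).fun_add
      (hg.mul_const (inner ℝ τ₀ n))
    simpa using this
  have l3 : HasDerivAt (fun v => γ₀ (a + v * inner ℝ τ₀ τ + g v * inner ℝ τ₀ n))
      (deriv γ₀ s * (inner ℝ τ₀ τ + g' * inner ℝ τ₀ n)) u := by
    refine HasDerivAt.comp (h₂ := γ₀) u ?_ l2
    rw [hS]
    exact h.hasDerivAt_graph hsr
  have hslope := l.unique (l3.congr_of_eventuallyEq hev)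
  rw [hsu, h.outwardNormal_curve hΩ hs hsr, hτ, hn]
  rw [hc, hd, hf, he] at hslope
  have hq : 0 < √(1 + deriv γ₀ a ^ 2) := sqrt_pos.2 (by positivity)
  have hq2 : √(1 + deriv γ₀ a ^ 2) ^ 2 = 1 + deriv γ₀ a ^ 2 := sq_sqrt (by positivity)
  have hp : 0 < √(1 + deriv γ₀ s ^ 2) := sqrt_pos.2 (by positivity)
  have hp2 : √(1 + deriv γ₀ s ^ 2) ^ 2 = 1 + deriv γ₀ s ^ 2 := sq_sqrt (by positivity)
  have hw : 0 < √(1 + g' ^ 2) := sqrt_pos.2 (by positivity)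
  have hw2 : √(1 + g' ^ 2) ^ 2 = 1 + g' ^ 2 := sq_sqrt (by positivity)
  generalize √(1 + deriv γ₀ a ^ 2) = q at *
  generalize √(1 + deriv γ₀ s ^ 2) = p at *
  generalize √(1 + g' ^ 2) = w at *
  generalize deriv γ₀ a = k at *
  generalize deriv γ₀ s = l at *
  have hkl : k + g' = l * (1 - g' * k) := by
    field_simp at hslope
    linarith
  -- the angle between the two tangents is acute, so both sides of the identity `hwq` are positive
  have hpos' : 0 < 1 - g' * k := by
    have : |g' * k| ≤ 1 * (1 / 2) := by
      rw [abs_mul]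
      exact mul_le_mul hg' hk (abs_nonneg _) zero_le_one
    linarith [le_abs_self (g' * k)]
  have hwq : w * q = (1 - g' * k) * p := by
    refine (pow_left_inj₀ (by positivity) (by positivity) two_ne_zero).1 ?_
    rw [mul_pow, mul_pow, hw2, hq2, hp2]
    linear_combination ((k + g') + l * (1 - g' * k)) * hkl
  have hratio : w * (1 / p) = (1 - g' * k) / q := by
    field_simp
    linarith
  rw [smul_smul, hratio]
  have e2 : (1 - g' * k) / q * l = (k + g') / q := by rw [hkl]; ring
  calc _ = ((1 - g' * k) / q) • n₀ - ((1 - g' * k) / q * l) • τ₀ := by module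
    _ = _ := by
      rw [e2]
      module

theorem abs_tangent_sub_le (h : IsGraphBox Ω b τ₀ n₀ γ₀ r R) (p q : Plane) :
    |inner ℝ τ₀ (p - b) - inner ℝ τ₀ (q - b)| ≤ dist p q := by
  rw [← inner_sub_right, sub_sub_sub_cancel_right, dist_eq_norm]
  have := abs_real_inner_le_norm τ₀ (p - q)
  rwa [h.norm_tangent, one_mul] at this

/-- Near the centre of a box, the tangent graphs at all boundary points have charts with common
constants. The chart at the point of abscissa `a` is `u ↦ normalCoord γ₀ (a, H (a, u))`, where
`H (a, ·)` inverts the tangential coordinate; it is smooth in `(a, u)` jointly, which gives the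
uniform bounds. Only tangents oriented as that of the box are treated. -/
theorem exists_uniformChart (h : IsGraphBox Ω b τ₀ n₀ γ₀ r R) (hΩ : IsOpen Ω)
    (hs : HasSmoothBoundary Ω) {μ : Plane → ℝ} (hμ : ContDiffOn ℝ ∞ μ (frontier Ω)) :
    ∃ ρ > 0, ∃ M, ∃ c > 0, ∀ᶠ x in 𝓝[frontier Ω] b, ∀ τ n γ, IsTangentGraph Ω x τ n γ →
      0 < inner ℝ τ₀ τ → ∃ g, IsUniformChart Ω μ x τ n γ ρ M c g := by
  have hr := h.radius_pos
  have hγ := h.contDiffAt_graph h.zero_mem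
  have hγ' := h.contDiffAt_deriv h.zero_mem
  have hm : ContDiffAt ℝ ∞ (fun s => μ (framePoint b τ₀ n₀ s (γ₀ s))) 0 := by
    refine ContDiffOn.contDiffAt (s := Ioo (-r) r) ?_ (isOpen_Ioo.mem_nhds h.zero_mem)
    refine hμ.comp ?_ fun s hs => h.curve_mem_frontier hΩ hs
    unfold framePoint
    exact (contDiffOn_const.add (contDiffOn_id.smul contDiffOn_const)).add
      (h.contDiffOn.smul contDiffOn_const)
  obtain ⟨H, hHs, hH0, ρ₁, hρ1, hH1, hH2⟩ :=
    exists_inverse_tangentCoord hγ hγ' h.deriv_zero (half_pos hr)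
  have hG : ContDiffAt ℝ ∞ (fun p : ℝ × ℝ => normalCoord γ₀ (p.1, H p)) (0, 0) := by
    refine ContDiffAt.comp (g := normalCoord γ₀) ((0 : ℝ), (0 : ℝ)) ?_ (contDiffAt_fst.prodMk hHs)
    rw [hH0]
    exact (contDiffAt_tangentCoord hγ hγ').2
  have hF : ContDiffAt ℝ ∞ (fun p : ℝ × ℝ => μ (framePoint b τ₀ n₀ (p.1 + H p) (γ₀ (p.1 + H p))))
      (0, 0) := by
    refine ContDiffAt.comp (g := fun s => μ (framePoint b τ₀ n₀ s (γ₀ s))) ((0 : ℝ), (0 : ℝ)) ?_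
      (contDiffAt_fst.add hHs)
    rw [hH0, add_zero]
    exact hm
  have hinf : ∀ k : ℕ, (k : ℕ∞ω) ≤ (∞ : ℕ∞ω) := fun k => by exact_mod_cast le_top
  obtain ⟨ρ₂, hρ2, M₂, hb2⟩ := exists_uniform_partial_bounds 6 (hG.of_le (hinf 6))
  obtain ⟨ρ₃, hρ3, M₃, hb3⟩ := exists_uniform_partial_bounds 4 (hF.of_le (hinf 4))
  set M := max |M₂| |M₃| with hM
  have hM0 : 0 ≤ M := (abs_nonneg _).trans (le_max_left _ _)
  -- the bound `ρ ≤ 1 / (M + 1)` makes the slope, at most `M * |u|`, at most `1`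
  obtain ⟨ρ, hρ, hρ1', hρ2', hρ3', hρr, hρM⟩ : ∃ ρ > 0, ρ ≤ ρ₁ ∧ ρ ≤ ρ₂ ∧ ρ ≤ ρ₃ ∧ ρ ≤ r / 2 ∧
      ρ ≤ 1 / (M + 1) := by
    refine ⟨min ρ₁ (min ρ₂ (min ρ₃ (min (r / 2) (1 / (M + 1))))), ?_, ?_, ?_, ?_, ?_, ?_⟩
    · have : 0 < 1 / (M + 1) := by positivity
      exact lt_min hρ1 (lt_min hρ2 (lt_min hρ3 (lt_min (half_pos hr) this)))
    all_goals simp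
  have hsub : ∀ {ρ' u : ℝ}, ρ ≤ ρ' → u ∈ Ioo (-ρ) ρ → u ∈ Ioo (-ρ') ρ' := fun hle hu =>
    Ioo_subset_Ioo (neg_le_neg hle) hle hu
  obtain ⟨ε, hε, hball⟩ := Metric.mem_nhdsWithin_iff.1 (h.eventually_mem_curve hΩ)
  refine ⟨ρ, hρ, M, min ρ (ε / 2), lt_min hρ (half_pos hε), ?_⟩
  refine Metric.mem_nhdsWithin_iff.2 ⟨min ρ (ε / 2), lt_min hρ (half_pos hε), ?_⟩
  rintro x ⟨hxb, hxf⟩ τ n γ h' hpos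
  have hxb' := Metric.mem_ball.1 hxb
  have hX0 : inner ℝ τ₀ (b - b) = (0 : ℝ) := by simp
  obtain ⟨-, hx⟩ := hball ⟨Metric.mem_ball.2 (hxb'.trans_le ((min_le_right _ _).trans
    (half_le_self hε.le))), hxf⟩
  have ha : inner ℝ τ₀ (x - b) ∈ Ioo (-ρ) ρ := by
    have := h.abs_tangent_sub_le x b
    rw [hX0, sub_zero] at this
    exact _root_.abs_lt.1 (this.trans_lt (hxb'.trans_le (min_le_left _ _)))
  -- replace `x` by the point of the graph with abscissa `a`
  obtain ⟨a, haX⟩ : ∃ a, a = inner ℝ τ₀ (x - b) := ⟨_, rfl⟩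
  rw [← haX] at hx ha
  have har2 : a ∈ Ioo (-(r / 2)) (r / 2) := hsub hρr ha
  have har : a ∈ Ioo (-r) r := ⟨by linarith [har2.1], by linarith [har2.2]⟩
  subst hx
  obtain ⟨-, -, -, -, hτ, hn⟩ := h.frame_eq hΩ har h' hpos
  set g : ℝ → ℝ := fun u => normalCoord γ₀ (a, H (a, u)) with hg
  have hgerm : g =ᶠ[𝓝 0] γ := h.germ_eq hΩ har h' hpos hρ fun t ht =>
    hH2 a (hsub hρ1' ha) t (hsub hρ1' ht)
  have hpt : ∀ u ∈ Ioo (-ρ) ρ, a + H (a, u) ∈ Ioo (-r) r ∧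
      framePoint (framePoint b τ₀ n₀ a (γ₀ a)) τ n u (g u) =
        framePoint b τ₀ n₀ (a + H (a, u)) (γ₀ (a + H (a, u))) := by
    intro u hu
    obtain ⟨m1, m2⟩ := hH1 a (hsub hρ1' ha) u (hsub hρ1' hu)
    refine ⟨⟨by linarith [har2.1, m1.1], by linarith [har2.2, m1.2]⟩, ?_⟩
    have := framePoint_coords (b := b) hτ hn (H (a, u))
    rwa [m2] at this
  have hdata : BoundedTangentData ρ M g
      (fun u => μ (framePoint (framePoint b τ₀ n₀ a (γ₀ a)) τ n u (g u))) := by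
    have hmeq : EqOn (fun u => μ (framePoint (framePoint b τ₀ n₀ a (γ₀ a)) τ n u (g u)))
        (fun u => μ (framePoint b τ₀ n₀ (a + H (a, u)) (γ₀ (a + H (a, u))))) (Ioo (-ρ) ρ) :=
      fun u hu => congrArg μ (hpt u hu).2
    obtain ⟨c2, b2⟩ := hb2 a (hsub hρ2' ha)
    obtain ⟨c3, b3⟩ := hb3 a (hsub hρ3' ha)
    refine ⟨c2.mono fun u hu => hsub hρ2' hu, (c3.mono fun u hu => hsub hρ3' hu).congr hmeq,
      fun k hk u hu => ?_, fun k hk u hu => ?_, ?_, ?_⟩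
    · exact (b2 k hk u (hsub hρ2' hu)).trans ((le_abs_self _).trans (le_max_left _ _))
    · rw [(hmeq.eventuallyEq_of_mem (isOpen_Ioo.mem_nhds hu)).iteratedDeriv_eq]
      exact (b3 k hk u (hsub hρ3' hu)).trans ((le_abs_self _).trans (le_max_right _ _))
    · rw [hgerm.self_of_nhds, h'.value_zero]
    · rw [hgerm.deriv_eq, h'.deriv_zero]
  have hslope : ∀ u ∈ Ioo (-ρ) ρ, |deriv g u| ≤ 1 := by
    intro u hu
    refine (hdata.slope_le hu).trans ?_
    have : |u| ≤ 1 / (M + 1) := (_root_.abs_lt.2 hu).le.trans hρM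
    calc M * |u| ≤ M * (1 / (M + 1)) := mul_le_mul_of_nonneg_left this hM0
      _ ≤ 1 := by
        rw [mul_one_div, div_le_one (by positivity)]
        linarith
  refine ⟨g, hdata, hgerm, hslope, fun u hu => ?_, fun u hu => ?_, ?_⟩
  · rw [(hpt u hu).2]
    exact h.curve_mem_frontier hΩ (hpt u hu).1
  · have hgd : HasDerivAt g (deriv g u) u :=
      ((hdata.contDiffOn_curve.contDiffAt (isOpen_Ioo.mem_nhds hu)).differentiableAt
        (by norm_num)).hasDerivAt
    refine h.normal_eq_of_graph hΩ hs har h' hpos hgd (hslope u hu) (hpt u hu).1 (hpt u hu).2 ?_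
    filter_upwards [isOpen_Ioo.mem_nhds hu] with v hv
    exact ⟨_, (hpt v hv).2⟩
  · rintro y ⟨hyf, hyx⟩
    have hyx' := Metric.mem_ball.1 hyx
    have hyb : dist y b < ε := by
      have := dist_triangle y (framePoint b τ₀ n₀ a (γ₀ a)) b
      have h1 := min_le_right ρ (ε / 2)
      linarith
    obtain ⟨-, hy⟩ := hball ⟨Metric.mem_ball.2 hyb, hyf⟩
    have ht : inner ℝ τ₀ (y - b) - a ∈ Ioo (-ρ) ρ := by
      have := h.abs_tangent_sub_le y (framePoint b τ₀ n₀ a (γ₀ a))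
      rw [← haX] at this
      exact _root_.abs_lt.1 (this.trans_lt (hyx'.trans_le (min_le_left _ _)))
    have hcoord := framePoint_coords (b := b) hτ hn (inner ℝ τ₀ (y - b) - a)
    rw [add_sub_cancel, ← hy] at hcoord
    have hHt := hH2 a (hsub hρ1' ha) _ (hsub hρ1' ht)
    refine ⟨tangentCoord γ₀ (a, inner ℝ τ₀ (y - b) - a), ?_, ?_⟩
    · have e := inner_framePoint_tangent h'.norm_tangent h'.inner_eq_zero
        (framePoint b τ₀ n₀ a (γ₀ a)) (tangentCoord γ₀ (a, inner ℝ τ₀ (y - b) - a))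
        (normalCoord γ₀ (a, inner ℝ τ₀ (y - b) - a))
      rw [hcoord] at e
      have hle := abs_real_inner_le_norm τ (y - framePoint b τ₀ n₀ a (γ₀ a))
      rw [e, h'.norm_tangent, one_mul, ← dist_eq_norm] at hle
      exact _root_.abs_lt.1 (hle.trans_lt (hyx'.trans_le (min_le_left _ _)))
    · simp only [hg, hHt]
      exact hcoord

end IsGraphBox

/-! ### The double layer kernel and the boundary integral -/

section Kernel

variable {Ω : Set Plane} {μ : Plane → ℝ} {x : Plane}

theorem doubleLayerKernel_eq {t : ℝ} (ht : 0 < t) (y : Plane) :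
    doubleLayerKernel Ω x t y =
      inner ℝ (x - y) (outwardNormal Ω y) * exp (-‖x - y‖ ^ 2 / (4 * t)) / (8 * π * t ^ 2) := by
  have h1 : HasFDerivAt (fun z : Plane => x - z) (-ContinuousLinearMap.id ℝ Plane) y := by
    simpa using (hasFDerivAt_id y).const_sub x
  have h2 : HasFDerivAt (fun z : Plane => heatKernel (x - z) t) _ y :=
    (((h1.norm_sq.neg).mul_const (4 * t)⁻¹).exp).mul_const (4 * π * t)⁻¹
  rw [doubleLayerKernel, h2.fderiv]
  simp only [_root_.smul_apply, _root_.neg_apply, smul_eq_mul,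
    ContinuousLinearMap.comp_apply, ContinuousLinearMap.id_apply, innerSL_apply_apply,
    inner_neg_right, Pi.neg_apply, div_eq_mul_inv, nsmul_eq_mul]
  field_simp
  push_cast
  ring

theorem abs_doubleLayerKernel_le {t : ℝ} (ht : 0 < t) (y : Plane) :
    |doubleLayerKernel Ω x t y| ≤
      ‖x - y‖ * exp (-‖x - y‖ ^ 2 / (4 * t)) / (8 * π * t ^ 2) := by
  rw [doubleLayerKernel_eq ht, abs_div, abs_mul, abs_of_pos (exp_pos _),
    abs_of_pos (by positivity : 0 < 8 * π * t ^ 2)]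
  gcongr
  refine (abs_real_inner_le_norm _ _).trans ?_
  exact mul_le_of_le_one_right (norm_nonneg _) norm_outwardNormal

theorem continuousOn_doubleLayerKernel (hΩ : IsOpen Ω) (hs : HasSmoothBoundary Ω)
    (hμ : ContinuousOn μ (frontier Ω)) {t : ℝ} (ht : 0 < t) :
    ContinuousOn (fun y => doubleLayerKernel Ω x t y * μ y) (frontier Ω) := by
  simp only [doubleLayerKernel_eq ht]
  have := continuousOn_outwardNormal hΩ hs
  fun_prop

/-- A Gaussian bound for the integrand of the double layer potential, uniform in both boundary
points. -/
theorem exists_kernel_bound (hcompact : IsCompact (frontier Ω))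
    (hμ : ContinuousOn μ (frontier Ω)) :
    ∃ D, 0 ≤ D ∧ ∀ x ∈ frontier Ω, ∀ y ∈ frontier Ω, ∀ t, 0 < t →
      |doubleLayerKernel Ω x t y * μ y| ≤ D * exp (-‖x - y‖ ^ 2 / (4 * t)) / t ^ 2 := by
  obtain ⟨K, hK⟩ := hcompact.exists_bound_of_continuousOn hμ
  obtain ⟨L, hL⟩ := hcompact.isBounded.exists_norm_le
  refine ⟨(|L| + |L|) / (8 * π) * |K|, by positivity, fun x hx y hy t ht => ?_⟩
  rw [abs_mul]
  have h1 : ‖x - y‖ ≤ |L| + |L| := (norm_sub_le _ _).trans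
    (add_le_add ((hL x hx).trans (le_abs_self _)) ((hL y hy).trans (le_abs_self _)))
  calc _ ≤ ‖x - y‖ * exp (-‖x - y‖ ^ 2 / (4 * t)) / (8 * π * t ^ 2) * |K| :=
        mul_le_mul (abs_doubleLayerKernel_le ht y) ((hK y hy).trans (le_abs_self _))
          (abs_nonneg _) (by positivity)
    _ ≤ (|L| + |L|) * exp (-‖x - y‖ ^ 2 / (4 * t)) / (8 * π * t ^ 2) * |K| := by gcongr
    _ = _ := by field_simp

theorem integrableOn_doubleLayerKernel (hΩ : IsOpen Ω) (hcompact : IsCompact (frontier Ω))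
    (hs : HasSmoothBoundary Ω) (hμ : ContinuousOn μ (frontier Ω)) {t : ℝ} (ht : 0 < t) :
    IntegrableOn (fun y => doubleLayerKernel Ω x t y * μ y) (frontier Ω) μH[1] := by
  have hc := continuousOn_doubleLayerKernel (x := x) hΩ hs hμ ht
  obtain ⟨K, hK⟩ := hcompact.exists_bound_of_continuousOn hc
  exact IntegrableOn.of_bound (hausdorffMeasure_frontier_lt_top hΩ hcompact hs)
    (hc.aestronglyMeasurable isClosed_frontier.measurableSet) K
    ((ae_restrict_iff' isClosed_frontier.measurableSet).2 (Eventually.of_forall hK))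

/-- The boundary integral is continuous in time, by dominated convergence. -/
theorem continuousOn_doubleLayerInner (hΩ : IsOpen Ω) (hcompact : IsCompact (frontier Ω))
    (hs : HasSmoothBoundary Ω) (hμ : ContinuousOn μ (frontier Ω)) (hx : x ∈ frontier Ω) :
    ContinuousOn (doubleLayerInner Ω μ x) (Ioi 0) := by
  intro t₀ ht₀
  have ht₀' : 0 < t₀ := ht₀
  refine ContinuousAt.continuousWithinAt ?_
  obtain ⟨D, hD0, hD⟩ := exists_kernel_bound hcompact hμ
  have hfin : IsFiniteMeasure ((μH[1] : Measure Plane).restrict (frontier Ω)) :=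
    ⟨by simpa using hausdorffMeasure_frontier_lt_top hΩ hcompact hs⟩
  have hev : ∀ᶠ t in 𝓝 t₀, t₀ / 2 < t := Ioi_mem_nhds (half_lt_self ht₀')
  refine continuousAt_of_dominated (bound := fun _ => D / (t₀ / 2) ^ 2) ?_ ?_
    (integrable_const _) ?_
  · filter_upwards [hev] with t ht
    exact (continuousOn_doubleLayerKernel hΩ hs hμ
      ((half_pos ht₀').trans ht)).aestronglyMeasurable isClosed_frontier.measurableSet
  · filter_upwards [hev] with t ht
    have ht' : 0 < t := (half_pos ht₀').trans ht
    filter_upwards [ae_restrict_mem isClosed_frontier.measurableSet] with y hy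
    refine (hD x hx y hy t ht').trans ?_
    have : exp (-‖x - y‖ ^ 2 / (4 * t)) ≤ 1 :=
      exp_le_one_iff.2 (div_nonpos_of_nonpos_of_nonneg (by simp) (by positivity))
    have h4 : 0 < t₀ / 2 := half_pos ht₀'
    calc _ ≤ D * 1 / t ^ 2 := by gcongr
      _ ≤ D * 1 / (t₀ / 2) ^ 2 := by gcongr
      _ = _ := by rw [mul_one]
  · refine Eventually.of_forall fun y => ?_
    have hcont : ContinuousAt (fun t => inner ℝ (x - y) (outwardNormal Ω y) *
        exp (-‖x - y‖ ^ 2 / (4 * t)) / (8 * π * t ^ 2) * μ y) t₀ := by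
      have h1 : 4 * t₀ ≠ 0 := by positivity
      have h2 : 8 * π * t₀ ^ 2 ≠ 0 := by positivity
      fun_prop (disch := assumption)
    refine hcont.congr ?_
    filter_upwards [Ioi_mem_nhds ht₀'] with t ht
    rw [doubleLayerKernel_eq ht]

end Kernel

/-- The heat kernel away from the origin, bounded through `exp z ≥ z ^ 4 / 4!`; the constant is
`4! * 4 ^ 4`. -/
theorem exp_neg_div_le {c t : ℝ} (hc : 0 < c) (ht : 0 < t) (ht1 : t ≤ 1) :
    exp (-c ^ 2 / (4 * t)) / t ^ 2 ≤ 6144 / c ^ 8 * (t * √t) := by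
  have h := pow_div_factorial_le_exp (c ^ 2 / (4 * t)) (by positivity) 4
  have hs : t ≤ √t := by
    rw [le_sqrt ht.le ht.le]
    nlinarith
  have he : exp (-c ^ 2 / (4 * t)) = (exp (c ^ 2 / (4 * t)))⁻¹ := by
    rw [← exp_neg]
    congr 1
    ring
  have hpos : 0 < (c ^ 2 / (4 * t)) ^ 4 / (Nat.factorial 4 : ℝ) := by positivity
  rw [he]
  calc (exp (c ^ 2 / (4 * t)))⁻¹ / t ^ 2
      ≤ ((c ^ 2 / (4 * t)) ^ 4 / (Nat.factorial 4 : ℝ))⁻¹ / t ^ 2 := by gcongr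
    _ = 6144 / c ^ 8 * (t * t) := by
      simp only [Nat.factorial]
      push_cast
      field_simp
      norm_num
    _ ≤ _ := by gcongr

/-! ### Expansion of the boundary integral -/

section Expansion

variable {Ω : Set Plane} {μ : Plane → ℝ} {x τ n : Plane} {γ g : ℝ → ℝ} {ρ M c : ℝ}

theorem IsUniformChart.hasStrictDerivAt (h : IsUniformChart Ω μ x τ n γ ρ M c g) {u : ℝ}
    (hu : u ∈ Ioo (-ρ) ρ) : HasStrictDerivAt g (deriv g u) u :=
  (h.data.contDiffOn_curve.contDiffAt (isOpen_Ioo.mem_nhds hu)).hasStrictDerivAt (by norm_num)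

theorem IsUniformChart.lipschitzOnWith (h : IsUniformChart Ω μ x τ n γ ρ M c g)
    (h' : IsTangentGraph Ω x τ n γ) :
    LipschitzOnWith 2 (fun u => framePoint x τ n u (g u)) (Ioo (-ρ) ρ) :=
  lipschitzOnWith_framePoint h'.norm_tangent h'.norm_normal
    (fun _ hu => (h.hasStrictDerivAt hu).hasDerivAt) h.slope_le

theorem IsTangentGraph.injOn_framePoint (h' : IsTangentGraph Ω x τ n γ) (g : ℝ → ℝ) (S : Set ℝ) :
    InjOn (fun u => framePoint x τ n u (g u)) S := by
  intro u _ v _ huv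
  have := congrArg (fun p => inner ℝ τ (p - x)) huv
  simpa only [inner_framePoint_tangent h'.norm_tangent h'.inner_eq_zero] using this

/-- The part of the boundary integral over the image of a uniform chart, in the parameter of the
chart. -/
theorem IsUniformChart.setIntegral_eq (h : IsUniformChart Ω μ x τ n γ ρ M c g)
    (h' : IsTangentGraph Ω x τ n γ) {t : ℝ} (ht : 0 < t) :
    ∫ y in (fun u => framePoint x τ n u (g u)) '' Ioo (-ρ) ρ,
        doubleLayerKernel Ω x t y * μ y ∂μH[1] =
      ∫ u in Ioo (-ρ) ρ, (u * deriv g u - g u) / (8 * π * t ^ 2) *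
        exp (-(u ^ 2 + g u ^ 2) / (4 * t)) * μ (framePoint x τ n u (g u)) := by
  rw [setIntegral_image_hausdorffMeasure (v := fun u => τ + deriv g u • n) isOpen_Ioo
    (by rw [Real.volume_Ioo]; exact ENNReal.ofReal_ne_top)
    (fun u hu => hasStrictDerivAt_framePoint (h.hasStrictDerivAt hu)) ?_
    (h.lipschitzOnWith h') (h'.injOn_framePoint g _)]
  · refine setIntegral_congr_fun measurableSet_Ioo fun u hu => ?_
    have hnorm : ‖τ + deriv g u • n‖ = √(1 + deriv g u ^ 2) := by
      have := norm_smul_add_smul_sq h'.norm_tangent h'.norm_normal h'.inner_eq_zero 1 (deriv g u)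
      rw [one_smul, one_pow] at this
      rw [← this, sqrt_sq (norm_nonneg _)]
    have hdist : ‖x - framePoint x τ n u (g u)‖ ^ 2 = u ^ 2 + g u ^ 2 := by
      rw [norm_sub_rev, norm_framePoint_sub_sq h'.norm_tangent h'.norm_normal h'.inner_eq_zero]
    have hin : √(1 + deriv g u ^ 2) *
        inner ℝ (x - framePoint x τ n u (g u)) (outwardNormal Ω (framePoint x τ n u (g u))) =
        u * deriv g u - g u := by
      rw [← real_inner_smul_right, h.normal_eq u hu, ← neg_sub, inner_neg_left, inner_sub_right,
        real_inner_smul_right, real_inner_comm,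
        inner_framePoint_normal h'.norm_normal h'.inner_eq_zero, real_inner_comm,
        inner_framePoint_tangent h'.norm_tangent h'.inner_eq_zero]
      ring
    rw [doubleLayerKernel_eq ht, hnorm, hdist, ← hin]
    ring
  · have := h.data.curve_continuousOn.2
    fun_prop

/-- The chart and the tangent graph have the same germ at the origin, so the coefficients can be
computed from either. -/
theorem IsUniformChart.expansion_eq (h : IsUniformChart Ω μ x τ n γ ρ M c g) (t : ℝ) :
    innerExpansion (iteratedDeriv 2 g 0) (iteratedDeriv 3 g 0) (iteratedDeriv 4 g 0)
      (μ (framePoint x τ n 0 (g 0))) (deriv (fun u => μ (framePoint x τ n u (g u))) 0)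
      (iteratedDeriv 2 (fun u => μ (framePoint x τ n u (g u))) 0) t =
    innerExpansion (iteratedDeriv 2 γ 0) (iteratedDeriv 3 γ 0) (iteratedDeriv 4 γ 0)
      (μ x) (tangentDeriv μ x τ n γ 1) (tangentDeriv μ x τ n γ 2) t := by
  have hm : (fun u => μ (framePoint x τ n u (g u))) =ᶠ[𝓝 0]
      fun u => μ (framePoint x τ n u (γ u)) := h.germ.mono fun u hu => by
    simp only [hu]
  rw [h.germ.iteratedDeriv_eq, h.germ.iteratedDeriv_eq, h.germ.iteratedDeriv_eq,
    hm.iteratedDeriv_eq, ← iteratedDeriv_one, hm.iteratedDeriv_eq, h.data.value_zero,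
    framePoint_zero, tangentDeriv, tangentDeriv]

/-- The boundary integral outside the image of a uniform chart is small. -/
theorem IsUniformChart.abs_setIntegral_diff_le (h : IsUniformChart Ω μ x τ n γ ρ M c g)
    (hc : 0 < c) (hfin : μH[1] (frontier Ω) < ⊤) {D : ℝ} (hD0 : 0 ≤ D)
    (hx : x ∈ frontier Ω)
    (hD : ∀ x ∈ frontier Ω, ∀ y ∈ frontier Ω, ∀ t, 0 < t →
      |doubleLayerKernel Ω x t y * μ y| ≤ D * exp (-‖x - y‖ ^ 2 / (4 * t)) / t ^ 2)
    {t : ℝ} (ht : 0 < t) (ht1 : t ≤ 1) :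
    |∫ y in frontier Ω \ (fun u => framePoint x τ n u (g u)) '' Ioo (-ρ) ρ,
        doubleLayerKernel Ω x t y * μ y ∂μH[1]| ≤
      D * (6144 / c ^ 8) * (μH[1] (frontier Ω)).toReal * (t * √t) := by
  have hfin' : μH[1] (frontier Ω \ (fun u => framePoint x τ n u (g u)) '' Ioo (-ρ) ρ) < ⊤ :=
    (measure_mono sdiff_subset).trans_lt hfin
  have hb := norm_setIntegral_le_of_norm_le_const (C := D * (6144 / c ^ 8 * (t * √t)))
    (f := fun y => doubleLayerKernel Ω x t y * μ y) hfin' ?_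
  · refine hb.trans ?_
    have hle : (μH[1] : Measure Plane).real
        (frontier Ω \ (fun u => framePoint x τ n u (g u)) '' Ioo (-ρ) ρ) ≤
        (μH[1] (frontier Ω)).toReal := ENNReal.toReal_mono hfin.ne (measure_mono sdiff_subset)
    calc _ ≤ D * (6144 / c ^ 8 * (t * √t)) * (μH[1] (frontier Ω)).toReal := by gcongr
      _ = _ := by ring
  · rintro y ⟨hy, hyW⟩
    have hdist : c ≤ ‖x - y‖ := by
      by_contra hlt
      refine hyW (h.cover ⟨hy, ?_⟩)
      rw [Metric.mem_ball, dist_eq_norm, norm_sub_rev]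
      exact not_le.1 hlt
    refine (hD x hx y hy t ht).trans ?_
    rw [mul_div_assoc]
    refine mul_le_mul_of_nonneg_left (le_trans ?_ (exp_neg_div_le hc ht ht1)) hD0
    gcongr

/-- Expansion of the boundary integral for base points near the centre of a box, in the tangent
frames that are oriented as the frame of the box. -/
theorem IsGraphBox.exists_inner_expansion {b τ₀ n₀ : Plane} {γ₀ : ℝ → ℝ} {r R : ℝ}
    (h : IsGraphBox Ω b τ₀ n₀ γ₀ r R) (hΩ : IsOpen Ω) (hcompact : IsCompact (frontier Ω))
    (hs : HasSmoothBoundary Ω) (hμ : ContDiffOn ℝ ∞ μ (frontier Ω)) :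
    ∃ C, 0 ≤ C ∧ ∀ᶠ x in 𝓝[frontier Ω] b, ∀ τ n γ, IsTangentGraph Ω x τ n γ →
      0 < inner ℝ τ₀ τ → ∀ t, 0 < t → t ≤ 1 →
        |doubleLayerInner Ω μ x t - innerExpansion (iteratedDeriv 2 γ 0) (iteratedDeriv 3 γ 0)
          (iteratedDeriv 4 γ 0) (μ x) (tangentDeriv μ x τ n γ 1) (tangentDeriv μ x τ n γ 2) t|
          ≤ C * (t * √t) := by
  obtain ⟨ρ, hρ, M, c, hc, hev⟩ := h.exists_uniformChart hΩ hs hμ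
  obtain ⟨C, hC0, hC⟩ := tangent_integral_expansion (M := M) hρ
  obtain ⟨D, hD0, hD⟩ := exists_kernel_bound hcompact hμ.continuousOn
  have hfin := hausdorffMeasure_frontier_lt_top hΩ hcompact hs
  refine ⟨C + D * (6144 / c ^ 8) * (μH[1] (frontier Ω)).toReal, by positivity, ?_⟩
  filter_upwards [hev, self_mem_nhdsWithin] with x hx hxf τ n γ h' hpos t ht ht1
  obtain ⟨g, hg⟩ := hx τ n γ h' hpos
  have hW : MeasurableSet ((fun u => framePoint x τ n u (g u)) '' Ioo (-ρ) ρ) :=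
    measurableSet_Ioo.image_of_continuousOn_injOn (hg.lipschitzOnWith h').continuousOn
      (h'.injOn_framePoint g _)
  have hsplit := integral_inter_add_sdiff hW
    (integrableOn_doubleLayerKernel (x := x) hΩ hcompact hs hμ.continuousOn ht)
  have hinter : frontier Ω ∩ (fun u => framePoint x τ n u (g u)) '' Ioo (-ρ) ρ =
      (fun u => framePoint x τ n u (g u)) '' Ioo (-ρ) ρ := by
    refine inter_eq_right.2 ?_
    rintro _ ⟨u, hu, rfl⟩
    exact hg.mem_frontier u hu
  rw [hinter, hg.setIntegral_eq h' ht] at hsplit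
  have h1 := hC g _ hg.data t ht
  rw [hg.expansion_eq] at h1
  have h2 := hg.abs_setIntegral_diff_le hc hfin hD0 hxf hD ht ht1
  rw [doubleLayerInner, ← hsplit, add_sub_right_comm, add_mul]
  exact (abs_add_le _ _).trans (add_le_add h1 h2)

/-- Expansion of the boundary integral near a boundary point, in tangent frames of either
orientation. -/
theorem exists_inner_expansion_nhds (hΩ : IsOpen Ω) (hcompact : IsCompact (frontier Ω))
    (hs : HasSmoothBoundary Ω) (hμ : ContDiffOn ℝ ∞ μ (frontier Ω)) {b : Plane}
    (hb : b ∈ frontier Ω) :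
    ∃ C, 0 ≤ C ∧ ∀ᶠ x in 𝓝[frontier Ω] b, ∀ τ n γ, IsTangentGraph Ω x τ n γ →
      ∀ t, 0 < t → t ≤ 1 →
        |doubleLayerInner Ω μ x t - innerExpansion (iteratedDeriv 2 γ 0) (iteratedDeriv 3 γ 0)
          (iteratedDeriv 4 γ 0) (μ x) (tangentDeriv μ x τ n γ 1) (tangentDeriv μ x τ n γ 2) t|
          ≤ C * (t * √t) := by
  obtain ⟨τ₀, n₀, γ₀, h⟩ := hs b hb
  obtain ⟨r, R, hbox⟩ := h.exists_isGraphBox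
  -- the reflected box serves the tangents with the opposite orientation
  obtain ⟨r', R', hbox'⟩ := h.reflect.exists_isGraphBox
  obtain ⟨C, hC0, hC⟩ := hbox.exists_inner_expansion hΩ hcompact hs hμ
  obtain ⟨C', hC0', hC'⟩ := hbox'.exists_inner_expansion hΩ hcompact hs hμ
  refine ⟨C + C', by positivity, ?_⟩
  filter_upwards [hC, hC', hbox.eventually_mem_curve hΩ] with x hx hx' hcurve τ n γ h' t ht ht1
  have hne : inner ℝ τ₀ τ ≠ (0 : ℝ) := by
    intro h0
    rw [hcurve.2] at h'
    have := (hbox.frame_unique hΩ hcurve.1 h').2.1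
    rw [h0] at this
    norm_num at this
  have hts : 0 ≤ t * √t := by positivity
  rcases lt_or_gt_of_ne hne with hneg | hpos
  · refine (hx' τ n γ h' (by rw [inner_neg_left]; linarith) t ht ht1).trans ?_
    nlinarith
  · refine (hx τ n γ h' hpos t ht ht1).trans ?_
    nlinarith

/-- Compactness of the boundary makes the constant of the local expansions uniform. -/
theorem exists_uniform_inner_expansion (hΩ : IsOpen Ω) (hcompact : IsCompact (frontier Ω))
    (hs : HasSmoothBoundary Ω) (hμ : ContDiffOn ℝ ∞ μ (frontier Ω)) :
    ∃ C, 0 ≤ C ∧ ∀ x ∈ frontier Ω, ∀ τ n γ, IsTangentGraph Ω x τ n γ →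
      ∀ t, 0 < t → t ≤ 1 →
        |doubleLayerInner Ω μ x t - innerExpansion (iteratedDeriv 2 γ 0) (iteratedDeriv 3 γ 0)
          (iteratedDeriv 4 γ 0) (μ x) (tangentDeriv μ x τ n γ 1) (tangentDeriv μ x τ n γ 2) t|
          ≤ C * (t * √t) := by
  refine hcompact.induction_on (p := fun S => ∃ C, 0 ≤ C ∧ ∀ x ∈ S, ∀ τ n γ,
    IsTangentGraph Ω x τ n γ → ∀ t, 0 < t → t ≤ 1 →
        |doubleLayerInner Ω μ x t - innerExpansion (iteratedDeriv 2 γ 0) (iteratedDeriv 3 γ 0)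
          (iteratedDeriv 4 γ 0) (μ x) (tangentDeriv μ x τ n γ 1) (tangentDeriv μ x τ n γ 2) t|
          ≤ C * (t * √t)) ⟨0, le_rfl, by simp⟩ ?_ ?_ ?_
  · rintro S T hST ⟨C, hC0, hC⟩
    exact ⟨C, hC0, fun x hx => hC x (hST hx)⟩
  · rintro S T ⟨C, hC0, hC⟩ ⟨C', hC0', hC'⟩
    refine ⟨C + C', by positivity, ?_⟩
    rintro x (hx | hx) τ n γ h' t ht ht1
    · refine (hC x hx τ n γ h' t ht ht1).trans ?_
      nlinarith [show 0 ≤ t * √t by positivity]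
    · refine (hC' x hx τ n γ h' t ht ht1).trans ?_
      nlinarith [show 0 ≤ t * √t by positivity]
  · intro b hb
    obtain ⟨C, hC0, hC⟩ := exists_inner_expansion_nhds hΩ hcompact hs hμ hb
    exact ⟨_, hC, C, hC0, fun x hx => hx⟩

end Expansion

/-! ### Integration in time -/

theorem sqrt_powers {t : ℝ} (ht : 0 ≤ t) :
    1 / √t = t ^ (-(1 / 2) : ℝ) ∧ √t = t ^ (1 / 2 : ℝ) ∧ t * √t = t ^ (3 / 2 : ℝ) := by
  refine ⟨?_, sqrt_eq_rpow t, ?_⟩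
  · rw [rpow_neg ht, ← sqrt_eq_rpow, one_div]
  · rw [sqrt_eq_rpow]
    conv_lhs => rw [← rpow_one t, ← rpow_mul ht, one_mul]
    rw [← rpow_add' ht (by norm_num)]
    norm_num

theorem intervalIntegrable_half_powers (A B δ : ℝ) :
    IntervalIntegrable (fun t => A * t ^ (-(1 / 2) : ℝ) + B * t ^ (1 / 2 : ℝ)) volume 0 δ :=
  ((intervalIntegral.intervalIntegrable_rpow' (by norm_num)).const_mul A).add
    ((intervalIntegral.intervalIntegrable_rpow' (by norm_num)).const_mul B)

/-- The expansion dominates `f` on `(0, 1]`; beyond, continuity suffices. -/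
theorem intervalIntegrable_of_expansion {f : ℝ → ℝ} (hf : ContinuousOn f (Ioi 0)) {A B C : ℝ}
    (h : ∀ t, 0 < t → t ≤ 1 → |f t - (A / √t + B * √t)| ≤ C * (t * √t)) {δ : ℝ} (hδ : 0 < δ) :
    IntervalIntegrable f volume 0 δ := by
  have h01 : IntervalIntegrable f volume 0 1 := by
    have hdom : IntervalIntegrable (fun t => |A| * t ^ (-(1 / 2) : ℝ) + |B| * t ^ (1 / 2 : ℝ) +
        C * t ^ (3 / 2 : ℝ)) volume 0 1 :=
      (intervalIntegrable_half_powers |A| |B| 1).add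
        ((intervalIntegral.intervalIntegrable_rpow' (by norm_num)).const_mul C)
    refine hdom.mono_fun' ?_ ?_
    · rw [uIoc_of_le zero_le_one]
      exact (hf.mono Ioc_subset_Ioi_self).aestronglyMeasurable measurableSet_Ioc
    · rw [uIoc_of_le zero_le_one]
      filter_upwards [ae_restrict_mem measurableSet_Ioc] with t ht
      obtain ⟨e1, e2, e3⟩ := sqrt_powers ht.1.le
      rw [← e1, ← e2, ← e3]
      have hb := h t ht.1 ht.2
      have ha : |A / √t + B * √t| ≤ |A| * (1 / √t) + |B| * √t := by
        refine (abs_add_le _ _).trans (le_of_eq ?_)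
        rw [abs_div, abs_mul, abs_of_nonneg (sqrt_nonneg t)]
        ring
      have := abs_sub_abs_le_abs_sub (f t) (A / √t + B * √t)
      rw [Real.norm_eq_abs]
      linarith
  refine h01.trans (ContinuousOn.intervalIntegrable (hf.mono fun t ht => ?_))
  exact (lt_min zero_lt_one hδ).trans_le ht.1

/-- Termwise integration of an expansion in half-integral powers. -/
theorem abs_integral_sub_le_of_expansion {f : ℝ → ℝ} {A B C δ : ℝ} (hδ : 0 < δ)
    (hf : IntervalIntegrable f volume 0 δ) (hC : 0 ≤ C)
    (h : ∀ t, 0 < t → t ≤ δ → |f t - (A / √t + B * √t)| ≤ C * (t * √t)) :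
    |(∫ t in (0 : ℝ)..δ, f t) - (2 * A * √δ + 2 / 3 * B * δ ^ (3 / 2 : ℝ))| ≤
      C * δ ^ (5 / 2 : ℝ) := by
  have i1 := intervalIntegrable_half_powers A B δ
  have e1 : ∫ t in (0 : ℝ)..δ, (A * t ^ (-(1 / 2) : ℝ) + B * t ^ (1 / 2 : ℝ)) =
      2 * A * √δ + 2 / 3 * B * δ ^ (3 / 2 : ℝ) := by
    rw [intervalIntegral.integral_add
      ((intervalIntegral.intervalIntegrable_rpow' (by norm_num)).const_mul A)
      ((intervalIntegral.intervalIntegrable_rpow' (by norm_num)).const_mul B),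
      intervalIntegral.integral_const_mul, intervalIntegral.integral_const_mul,
      integral_rpow (Or.inl (by norm_num)), integral_rpow (Or.inl (by norm_num)), sqrt_eq_rpow,
      zero_rpow (by norm_num), zero_rpow (by norm_num)]
    norm_num
    ring
  have i2 : IntervalIntegrable (fun t => C * t ^ (3 / 2 : ℝ)) volume 0 δ :=
    (intervalIntegral.intervalIntegrable_rpow' (by norm_num)).const_mul C
  have e2 : ∫ t in (0 : ℝ)..δ, C * t ^ (3 / 2 : ℝ) = 2 / 5 * C * δ ^ (5 / 2 : ℝ) := by
    rw [intervalIntegral.integral_const_mul, integral_rpow (Or.inl (by norm_num)),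
      zero_rpow (by norm_num)]
    norm_num
    ring
  rw [← e1, ← intervalIntegral.integral_sub hf i1]
  refine (intervalIntegral.norm_integral_le_of_norm_le
    (f := fun t => f t - (A * t ^ (-(1 / 2) : ℝ) + B * t ^ (1 / 2 : ℝ))) hδ.le ?_ i2).trans ?_
  · refine Eventually.of_forall fun t ht => ?_
    obtain ⟨p1, p2, p3⟩ := sqrt_powers ht.1.le
    rw [← p1, ← p2, ← p3, mul_one_div]
    exact h t ht.1 ht.2
  · rw [e2]
    have : 0 ≤ C * δ ^ (5 / 2 : ℝ) := by positivity
    linarith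

end

theorem corollary4p4 (Ω : Set Plane) (hΩ : IsOpen Ω) (hcompact : IsCompact (frontier Ω))
    (hsmooth : HasSmoothBoundary Ω) (μ : Plane → ℝ) (hμ : ContDiffOn ℝ ∞ μ (frontier Ω)) :
    -- the integrals that define the potential converge absolutely
    (∀ x ∈ frontier Ω, ∀ t : ℝ, 0 < t →
      MeasureTheory.IntegrableOn (fun y => doubleLayerKernel Ω x t y * μ y) (frontier Ω) μH[1]) ∧
    (∀ x ∈ frontier Ω, ∀ δ : ℝ, 0 < δ →
      IntervalIntegrable (doubleLayerInner Ω μ x) MeasureTheory.volume 0 δ) ∧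
    -- the expansion, uniformly on the boundary
    ∃ C δ₀ : ℝ, 0 < δ₀ ∧
      ∀ x ∈ frontier Ω, ∀ (τ n : Plane) (γ : ℝ → ℝ), IsTangentGraph Ω x τ n γ →
        ∀ δ : ℝ, 0 < δ → δ < δ₀ →
          |localDoubleLayer Ω μ δ x -
            (Real.sqrt δ * (iteratedDeriv 2 γ 0 * μ x / (2 * Real.sqrt Real.pi)) +
              δ ^ (3 / 2 : ℝ) *
                (-(5 * iteratedDeriv 2 γ 0 ^ 3 * μ x / (8 * Real.sqrt Real.pi)) +
                  iteratedDeriv 2 γ 0 * tangentDeriv μ x τ n γ 2 / (2 * Real.sqrt Real.pi) +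
                  2 * tangentDeriv μ x τ n γ 1 * iteratedDeriv 3 γ 0 / (3 * Real.sqrt Real.pi) +
                  μ x * iteratedDeriv 4 γ 0 / (4 * Real.sqrt Real.pi)))|
            ≤ C * δ ^ (5 / 2 : ℝ) := by
  obtain ⟨C, hC0, hC⟩ := exists_uniform_inner_expansion hΩ hcompact hsmooth hμ
  have hint : ∀ x ∈ frontier Ω, ∀ δ : ℝ, 0 < δ →
      IntervalIntegrable (doubleLayerInner Ω μ x) MeasureTheory.volume 0 δ := by
    intro x hx δ hδ
    obtain ⟨τ, n, γ, h⟩ := hsmooth x hx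
    exact intervalIntegrable_of_expansion
      (continuousOn_doubleLayerInner hΩ hcompact hsmooth hμ.continuousOn hx)
      (hC x hx τ n γ h) hδ
  refine ⟨fun x _ t ht => integrableOn_doubleLayerKernel hΩ hcompact hsmooth hμ.continuousOn ht,
    hint, C, 1, zero_lt_one, fun x hx τ n γ h δ hδ hδ1 => ?_⟩
  have hmain := abs_integral_sub_le_of_expansion hδ (hint x hx δ hδ) hC0
    fun t ht htδ => hC x hx τ n γ h t ht (htδ.trans hδ1.le)
  have hp : 0 < Real.sqrt Real.pi := Real.sqrt_pos.2 Real.pi_pos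
  refine le_trans (le_of_eq ?_) hmain
  rw [localDoubleLayer]
  congr 2
  field_simp
  ring
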